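/- Let $n \ge 1$ and let $(W_n, S_n)$ be the Coxeter system of type $B_n$, with $S_n = \{t, s_1, \dots, s_{n-1}\}$, where $ts_1$ has order $4$, $s_is_{i+1}$ has order $3$, and all other pairs of distinct generators commute. Let $\ell$ be the length function, let $\ell_t(w)$ be the number of occurrences of $t$ in a reduced expression of $w$, and put $\ell_s = \ell - \ell_t$. Let $\Gamma = \mathbb{Z}^2$ with the lexicographic order, let $A = \mathbb{Z}[\Gamma]$ with $\mathbb{Z}$-basis $(v^\gamma)_{\gamma\in\Gamma}$, put $V = v^{(1,0)}$, let $A_{<0} = \bigoplus_{\gamma<0}\mathbb{Z}v^\gamma$, and let $L(w) = (\ell_t(w), \ell_s(w)) \in \Gamma$. Let $\mathcal{H}_n$ be the Hecke algebra of $(W_n,S_n,L)$: the associative $A$-algebra with $A$-basis $(T_w)_{w \in W_n}$ such that $T_wT_{w'} = T_{ww'}$ if $\ell(ww')=\ell(w)+\ell(w')$, and $T_s^2 = 1 + (v^{L(s)} - v^{-L(s)})T_s$ for $s \in S_n$. Let $h = \sum_w a_wT_w \mapsto \overline{h} = \sum_w \overline{a_w}\, T_{w^{-1}}^{-1}$ be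 its semilinear involution, where $\overline{v^\gamma} = v^{-\gamma}$; for $w \in W_n$ let $C_w$ be the unique element of $\mathcal{H}_n$ with $\overline{C_w} = C_w$ and $C_w \in T_w + \bigoplus_{y} A_{<0}T_y$ (the Kazhdan–Lusztig basis); and let $\tau : \mathcal{H}_n \to A$ be the $A$-linear map with $\tau(T_w) = \delta_{1,w}$. Let $r_1 = t_1 = t$ and, for $1 \le i \le n-1$, let $r_{i+1} = s_ir_i$ and $t_{i+1} = s_it_is_i$. For $0 \le l \le n$ let $a_l = r_1r_2\cdots r_l$, let $\mathfrak{S}_l$ be the subgroup of $W_n$ generated by $s_1, \dots, s_{l-1}$, let $\sigma_l$ be the longest element of $\mathfrak{S}_l$, and let $$P_l = (T_{t_1}+V^{-1})(T_{t_2}+V^{-1})\cdots(T_{t_l}+V^{-1}).$$ Then, for all $0 \le l \le n$, $$C_{a_l} = P_l\,T_{\sigma_l}^{-1} = T_{\sigma_l}^{-1}\,P_l ,$$ and, for every $\sigma \in \mathfrak{S}_n$, $$C_{a_l}C_\sigma = C_{a_l\sigma} \qquad\text{and}\qquad \tau(C_{a_l\sigma}) = V^{-l}\,\tau\bigl(T_{\sigma_l}^{-1}C_\sigma\bigr).$$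 -/

import Mathlib

namespace CoxeterKL

section Exchange

variable {B W : Type*} [Group W] {M : CoxeterMatrix B} (cs : CoxeterSystem M W)

open Classical in
/-- The involution `(r, e) ↦ (s r s, e + [r = s])`, used to show that the set of inversions read off a
reduced word depends only on the product of the word. -/
noncomputable def invPerm (i : B) : Equiv.Perm (W × ZMod 2) :=
  Function.Involutive.toPerm
    (fun p => (cs.simple i * p.1 * cs.simple i, p.2 + if p.1 = cs.simple i then 1 else 0))
    (by
      rintro ⟨r, e⟩
      have h : (cs.simple i * r * cs.simple i = cs.simple i) ↔ r = cs.simple i := by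
        constructor
        · intro h
          have h2 : cs.simple i * r = 1 := mul_eq_right.mp h
          rw [← cs.inv_simple i]
          exact eq_inv_of_mul_eq_one_right h2
        · rintro rfl; simp
      have h2 : (1 : ZMod 2) + 1 = 0 := by decide
      ext
      · simp [mul_assoc]
      · simp only [h]
        split_ifs
        · rw [add_assoc, h2, add_zero]
        · simp)

open Classical in
theorem invPerm_word (ω : List B) (p : W × ZMod 2) :
    (ω.map (invPerm cs)).prod p =
      (cs.wordProd ω * p.1 * (cs.wordProd ω)⁻¹,
        p.2 + (((cs.rightInvSeq ω).count p.1 : ℕ) : ZMod 2)) := by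
  induction ω with
  | nil => simp
  | cons i ω ih =>
    rw [List.map_cons, List.prod_cons, Equiv.Perm.mul_apply, ih]
    have h : (cs.wordProd ω * p.1 * (cs.wordProd ω)⁻¹ = cs.simple i) ↔
        (cs.wordProd ω)⁻¹ * cs.simple i * cs.wordProd ω = p.1 := by
      constructor
      · intro h; rw [← h]; group
      · intro h; rw [← h]; group
    ext
    · simp [invPerm, Function.Involutive.toPerm, cs.wordProd_cons, mul_assoc]
    · simp only [invPerm, Function.Involutive.toPerm, Equiv.coe_fn_mk, CoxeterSystem.rightInvSeq,
        List.count_cons, h, beq_iff_eq]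
      split_ifs <;> simp [add_assoc]

open Classical in
theorem count_leftInvSeq_braid (i j : B) (r : W) :
    (((cs.leftInvSeq (CoxeterSystem.alternatingWord i j (2 * M i j))).count r : ℕ) : ZMod 2)
      = 0 := by
  have h1 : cs.leftInvSeq (CoxeterSystem.alternatingWord i j (2 * M i j)) =
      (List.range (2 * M i j)).map
        (fun k => cs.wordProd (CoxeterSystem.alternatingWord j i (2 * k + 1))) := by
    apply List.ext_getElem
    · simp
    · intro k hk1 hk2
      rw [cs.getElem_leftInvSeq_alternatingWord i j (M i j) k (by simpa using hk1)]
      simp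
  have h2 : ∀ k, cs.wordProd (CoxeterSystem.alternatingWord j i (2 * (M i j + k) + 1)) =
      cs.wordProd (CoxeterSystem.alternatingWord j i (2 * k + 1)) := by
    intro k
    rw [cs.prod_alternatingWord_eq_mul_pow, cs.prod_alternatingWord_eq_mul_pow]
    have e1 : (2 * (M i j + k) + 1) / 2 = M i j + k := by omega
    have e2 : (2 * k + 1) / 2 = k := by omega
    rw [e1, e2, pow_add, M.symmetric i j, cs.simple_mul_simple_pow]
    simp
  rw [h1, two_mul, List.range_add, List.map_append, List.count_append, List.map_map]
  have h3 : ((fun k => cs.wordProd (CoxeterSystem.alternatingWord j i (2 * k + 1))) ∘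
      fun x => M i j + x) = fun k => cs.wordProd (CoxeterSystem.alternatingWord j i (2 * k + 1)) := by
    funext k; exact h2 k
  rw [h3]
  push_cast
  exact CharTwo.add_self_eq_zero _

theorem invPerm_mul_self (i : B) : invPerm cs i * invPerm cs i = 1 := by
  ext1 p
  exact (invPerm cs i).left_inv p

theorem invPerm_reverse (ω : List B) :
    (ω.map (invPerm cs)).prod * (ω.reverse.map (invPerm cs)).prod = 1 := by
  induction ω with
  | nil => simp
  | cons i ω ih =>
    rw [List.reverse_cons, List.map_append, List.prod_append, List.map_cons, List.prod_cons,
      mul_assoc, ← mul_assoc _ _ (List.map _ [i]).prod, ih]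
    simp [invPerm_mul_self]

theorem invPerm_alternating (i j : B) (m : ℕ) :
    ((CoxeterSystem.alternatingWord i j (2 * m)).map (invPerm cs)).prod =
      (invPerm cs i * invPerm cs j) ^ m := by
  induction m with
  | zero => simp [CoxeterSystem.alternatingWord]
  | succ m ih =>
    rw [Nat.mul_succ, CoxeterSystem.alternatingWord_succ, CoxeterSystem.alternatingWord_succ]
    simp only [List.concat_eq_append, List.map_append, List.prod_append, ih, pow_succ]
    simp [mul_assoc]

theorem invPerm_isLiftable : M.IsLiftable (invPerm cs) := by
  classical
  intro i j
  rw [← invPerm_alternating]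
  have h := invPerm_reverse cs (CoxeterSystem.alternatingWord i j (2 * M i j))
  suffices h1 : ((CoxeterSystem.alternatingWord i j (2 * M i j)).reverse.map (invPerm cs)).prod = 1 by
    rwa [h1, mul_one] at h
  have hp : cs.wordProd (CoxeterSystem.alternatingWord i j (2 * M i j)) = 1 := by
    rw [cs.prod_alternatingWord_eq_mul_pow]
    simp
  ext1 p
  rw [invPerm_word, cs.wordProd_reverse, hp, cs.rightInvSeq_reverse, List.count_reverse,
    count_leftInvSeq_braid]
  simp

open Classical in
theorem count_rightInvSeq_congr {ω ω' : List B} (h : cs.wordProd ω = cs.wordProd ω') (r : W) :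
    (((cs.rightInvSeq ω).count r : ℕ) : ZMod 2) = (((cs.rightInvSeq ω').count r : ℕ) : ZMod 2) := by
  have key : ∀ ω : List B, (cs.lift ⟨_, invPerm_isLiftable cs⟩) (cs.wordProd ω) =
      (ω.map (invPerm cs)).prod := by
    intro ω
    rw [CoxeterSystem.wordProd, map_list_prod, List.map_map]
    congr 2
    funext i
    simp
  have h1 : (ω.map (invPerm cs)).prod = (ω'.map (invPerm cs)).prod := by
    rw [← key, ← key, h]
  have h2 := congrArg (fun f : Equiv.Perm (W × ZMod 2) => (f (r, 0)).2) h1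
  simpa [invPerm_word] using h2

theorem rightInvSeq_perm {ω ω' : List B} (hω : cs.IsReduced ω) (hω' : cs.IsReduced ω')
    (h : cs.wordProd ω = cs.wordProd ω') :
    (cs.rightInvSeq ω).Perm (cs.rightInvSeq ω') := by
  classical
  rw [List.perm_iff_count]
  intro r
  have h1 := List.nodup_iff_count_le_one.mp hω.nodup_rightInvSeq r
  have h2 := List.nodup_iff_count_le_one.mp hω'.nodup_rightInvSeq r
  have h3 := count_rightInvSeq_congr cs h r
  rw [ZMod.natCast_eq_natCast_iff'] at h3
  omega

/-- If `s w` and `w t` are longer than `w` but `s w t` is not longer than these, then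
`s w = w t`. -/
theorem simple_mul_eq_mul_simple {w : W} {i j : B}
    (h1 : cs.length (cs.simple i * w) = cs.length w + 1)
    (h2 : cs.length (w * cs.simple j) = cs.length w + 1)
    (h3 : cs.length (cs.simple i * w * cs.simple j) = cs.length w) :
    cs.simple i * w = w * cs.simple j := by
  obtain ⟨ω, hω, rfl⟩ := cs.exists_isReduced w
  obtain ⟨ψ, hψ, hψw⟩ := cs.exists_isReduced (cs.simple i * cs.wordProd ω * cs.simple j)
  have e1 : cs.wordProd (ψ.concat j) = cs.wordProd (i :: ω) := by
    rw [cs.wordProd_concat, ← hψw, cs.wordProd_cons]; simp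
  have r1 : cs.IsReduced (ψ.concat j) := by
    have := hψ.eq
    rw [← hψw, h3] at this
    rw [CoxeterSystem.IsReduced, e1, cs.wordProd_cons, h1, List.length_concat, this]
  have r2 : cs.IsReduced (i :: ω) := by
    rw [CoxeterSystem.IsReduced, cs.wordProd_cons, h1, hω.eq]; simp
  have r3 : cs.IsReduced (ω.concat j) := by
    rw [CoxeterSystem.IsReduced, cs.wordProd_concat, h2, hω.eq]; simp
  have m1 : cs.simple j ∈ cs.rightInvSeq (i :: ω) := by
    rw [← (rightInvSeq_perm cs r1 r2 e1).mem_iff, cs.rightInvSeq_concat]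
    simp
  rw [CoxeterSystem.rightInvSeq, List.mem_cons] at m1
  rcases m1 with m1 | m1
  · rw [m1]; group
  · exfalso
    have n3 := r3.nodup_rightInvSeq
    rw [cs.rightInvSeq_concat, List.concat_eq_append, List.nodup_append] at n3
    refine n3.2.2 (cs.simple j) ?_ (cs.simple j) (by simp) rfl
    rw [List.mem_map]
    exact ⟨cs.simple j, m1, by simp⟩

end Exchange

section GroupRing

/-- The group ring `A = ℤ[Γ]`. -/
def GroupRing (Γ : Type*) : Type _ := AddMonoidAlgebra ℤ Γ

/-- The coefficient `a_γ` of `a` on `v ^ γ`. -/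
def GroupRing.coeffAt {Γ : Type*} (a : GroupRing Γ) (γ : Γ) : ℤ := AddMonoidAlgebra.coeff a γ

theorem groupRing_ext {Γ : Type*} {a b : GroupRing Γ} (h : ∀ γ, a.coeffAt γ = b.coeffAt γ) :
    a = b :=
  AddMonoidAlgebra.coeff_injective (Finsupp.ext h)

variable {Γ : Type*} [AddCommGroup Γ]

noncomputable instance : CommRing (GroupRing Γ) :=
  inferInstanceAs (CommRing (AddMonoidAlgebra ℤ Γ))

/-- The basis element `v ^ γ` of `A`. -/
noncomputable def vpow (γ : Γ) : GroupRing Γ := AddMonoidAlgebra.single γ 1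

/-- The involution `v ^ γ ↦ v ^ (-γ)` of `A`. -/
noncomputable def barA : GroupRing Γ ≃+* GroupRing Γ :=
  AddMonoidAlgebra.mapDomainRingEquiv ℤ (AddEquiv.neg Γ)

theorem coeffAt_barA (a : GroupRing Γ) (γ : Γ) : (barA a).coeffAt γ = a.coeffAt (-γ) := by
  have h := AddMonoidAlgebra.coeff_mapDomainRingEquiv (R := ℤ) (AddEquiv.neg Γ) a
  exact DFunLike.congr_fun h γ

theorem coeffAt_sub (a b : GroupRing Γ) (γ : Γ) :
    (a - b).coeffAt γ = a.coeffAt γ - b.coeffAt γ := rfl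

theorem coeffAt_add (a b : GroupRing Γ) (γ : Γ) :
    (a + b).coeffAt γ = a.coeffAt γ + b.coeffAt γ := rfl

theorem coeffAt_neg (a : GroupRing Γ) (γ : Γ) : (-a).coeffAt γ = -a.coeffAt γ := rfl

theorem coeffAt_zero (γ : Γ) : (0 : GroupRing Γ).coeffAt γ = 0 := rfl

theorem barA_barA (a : GroupRing Γ) : barA (barA a) = a :=
  groupRing_ext fun γ => by rw [coeffAt_barA, coeffAt_barA, neg_neg]

theorem barA_vpow (γ : Γ) : barA (vpow γ) = vpow (-γ) :=
  AddMonoidAlgebra.mapDomainRingEquiv_single (R := ℤ) (AddEquiv.neg Γ) 1 γ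

end GroupRing

section Hecke

variable {B W : Type*} [Group W] {M : CoxeterMatrix B} {cs : CoxeterSystem M W}
variable {Γ : Type*} [AddCommGroup Γ] [LinearOrder Γ]

/-- A weight function `L : W → Γ`: `L(ww') = L(w) + L(w')` whenever `ℓ(ww') = ℓ(w) + ℓ(w')`, and
`L(s) > 0` for every simple reflection `s`. -/
structure WeightFunction (cs : CoxeterSystem M W) (Γ : Type*) [AddCommGroup Γ] [LinearOrder Γ] where
  toFun : W → Γ
  map_mul' : ∀ w w' : W, cs.length (w * w') = cs.length w + cs.length w' →
    toFun (w * w') = toFun w + toFun w'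
  pos' : ∀ i : B, 0 < toFun (cs.simple i)

/-- `a ∈ A_{< 0}`. -/
def IsNegative (a : GroupRing Γ) : Prop := ∀ γ : Γ, a.coeffAt γ ≠ 0 → γ < 0

/-- `v ^ L(s) - v ^ (-L(s))`. -/
noncomputable def xi (L : WeightFunction cs Γ) (i : B) : GroupRing Γ :=
  vpow (L.toFun (cs.simple i)) - vpow (-L.toFun (cs.simple i))

/-- The free `A`-module with basis `(e_w)` indexed by `W`. -/
def FreeMod (W Γ : Type*) [AddCommGroup Γ] : Type _ := W →₀ GroupRing Γ

noncomputable instance : AddCommGroup (FreeMod W Γ) :=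
  inferInstanceAs (AddCommGroup (W →₀ GroupRing Γ))

noncomputable instance : Module (GroupRing Γ) (FreeMod W Γ) :=
  inferInstanceAs (Module (GroupRing Γ) (W →₀ GroupRing Γ))

/-- The basis `(e_w)`. -/
noncomputable def stdBasis (W Γ : Type*) [AddCommGroup Γ] :
    Module.Basis W (GroupRing Γ) (FreeMod W Γ) :=
  .ofRepr (LinearEquiv.refl (GroupRing Γ) (W →₀ GroupRing Γ))

/-- The operator on the free module that becomes left multiplication by `T_s`: `e_w ↦ e_{sw}` if
`ℓ(sw) > ℓ(w)`, and `e_w ↦ e_{sw} + (v ^ L(s) - v ^ (-L(s))) e_w` otherwise. -/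
noncomputable def leftOp (L : WeightFunction cs Γ) (i : B) :
    Module.End (GroupRing Γ) (FreeMod W Γ) :=
  (stdBasis W Γ).constr (GroupRing Γ) fun w =>
    if cs.length w < cs.length (cs.simple i * w) then stdBasis W Γ (cs.simple i * w)
    else stdBasis W Γ (cs.simple i * w) + xi L i • stdBasis W Γ w

/-- The analogous operator on the right; it commutes with all `leftOp`. -/
noncomputable def rightOp (L : WeightFunction cs Γ) (i : B) :
    Module.End (GroupRing Γ) (FreeMod W Γ) :=
  (stdBasis W Γ).constr (GroupRing Γ) fun w =>
    if cs.length w < cs.length (w * cs.simple i) then stdBasis W Γ (w * cs.simple i)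
    else stdBasis W Γ (w * cs.simple i) + xi L i • stdBasis W Γ w

/-- The algebra of endomorphisms of the free module generated by the operators `leftOp`. -/
noncomputable def heckeSubalgebra (L : WeightFunction cs Γ) :
    Subalgebra (GroupRing Γ) (Module.End (GroupRing Γ) (FreeMod W Γ)) :=
  Algebra.adjoin (GroupRing Γ) (Set.range (leftOp L))

/-- The Hecke algebra `H(W, S, L)` over `A = ℤ[Γ]`, realised as the algebra of endomorphisms of the
free module with basis `(e_w)` generated by the left multiplication operators. It has the `A`-basis
`T L` with the defining relations `T_mul` and `T_simple_sq` proved below. -/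
def Hecke (L : WeightFunction cs Γ) : Type _ := heckeSubalgebra L

noncomputable instance (L : WeightFunction cs Γ) : Ring (Hecke L) :=
  inferInstanceAs (Ring (heckeSubalgebra L))

noncomputable instance (L : WeightFunction cs Γ) : Algebra (GroupRing Γ) (Hecke L) :=
  inferInstanceAs (Algebra (GroupRing Γ) (heckeSubalgebra L))

theorem leftOp_up (L : WeightFunction cs Γ) {i : B} {w : W}
    (h : cs.length (cs.simple i * w) = cs.length w + 1) :
    leftOp L i (stdBasis W Γ w) = stdBasis W Γ (cs.simple i * w) := by
  rw [leftOp, Module.Basis.constr_basis, if_pos (by omega)]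

theorem leftOp_down (L : WeightFunction cs Γ) {i : B} {w : W}
    (h : cs.length (cs.simple i * w) + 1 = cs.length w) :
    leftOp L i (stdBasis W Γ w) =
      stdBasis W Γ (cs.simple i * w) + xi L i • stdBasis W Γ w := by
  rw [leftOp, Module.Basis.constr_basis, if_neg (by omega)]

theorem rightOp_up (L : WeightFunction cs Γ) {i : B} {w : W}
    (h : cs.length (w * cs.simple i) = cs.length w + 1) :
    rightOp L i (stdBasis W Γ w) = stdBasis W Γ (w * cs.simple i) := by
  rw [rightOp, Module.Basis.constr_basis, if_pos (by omega)]

theorem rightOp_down (L : WeightFunction cs Γ) {i : B} {w : W}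
    (h : cs.length (w * cs.simple i) + 1 = cs.length w) :
    rightOp L i (stdBasis W Γ w) =
      stdBasis W Γ (w * cs.simple i) + xi L i • stdBasis W Γ w := by
  rw [rightOp, Module.Basis.constr_basis, if_neg (by omega)]

theorem xi_eq (L : WeightFunction cs Γ) {w : W} {i j : B}
    (h1 : cs.length (cs.simple i * w) = cs.length w + 1)
    (h : cs.simple i * w = w * cs.simple j) : xi L i = xi L j := by
  have e1 := L.map_mul' (cs.simple i) w (by rw [h1, cs.length_simple, add_comm])
  have e2 := L.map_mul' w (cs.simple j) (by rw [← h, h1, cs.length_simple])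
  rw [h, e2, add_comm] at e1
  rw [xi, xi, add_right_cancel e1]

theorem leftOp_rightOp (L : WeightFunction cs Γ) (i j : B) :
    rightOp L j * leftOp L i = leftOp L i * rightOp L j := by
  refine (stdBasis W Γ).ext fun w => ?_
  simp only [Module.End.mul_apply]
  have ass : cs.simple i * (w * cs.simple j) = cs.simple i * w * cs.simple j :=
    (mul_assoc _ _ _).symm
  have a1 : cs.simple i * (cs.simple i * w) = w := by simp
  have a2 : w * cs.simple j * cs.simple j = w := by simp
  have a3 : cs.simple i * (cs.simple i * w * cs.simple j) = w * cs.simple j := by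
    simp [← mul_assoc]
  have a4 : cs.simple i * w * cs.simple j * cs.simple j = cs.simple i * w := by simp
  have b1 := cs.length_simple_mul w i
  have b2 := cs.length_mul_simple w j
  have b3 := cs.length_mul_simple (cs.simple i * w) j
  have b4 := cs.length_simple_mul (w * cs.simple j) i
  rw [ass] at b4
  rcases b1 with b1 | b1 <;> rcases b2 with b2 | b2
  · rw [leftOp_up L b1, rightOp_up L b2]
    rcases b3 with b3 | b3
    · rw [rightOp_up L b3, leftOp_up L (by rw [ass]; omega), ass]
    · have e := simple_mul_eq_mul_simple cs b1 b2 (by omega)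
      rw [rightOp_down L b3, leftOp_down L (by rw [ass]; omega), ass, xi_eq L b1 e, e]
  · have b3' : cs.length (cs.simple i * w * cs.simple j) + 1 = cs.length (cs.simple i * w) := by
      omega
    rw [leftOp_up L b1, rightOp_down L b2, rightOp_down L b3', map_add, map_smul, leftOp_up L b1,
      leftOp_up L (by rw [ass]; omega), ass]
  · have b3' : cs.length (cs.simple i * w * cs.simple j) = cs.length (cs.simple i * w) + 1 := by
      omega
    rw [leftOp_down L b1, rightOp_up L b2, map_add, map_smul, rightOp_up L b3', rightOp_up L b2,
      leftOp_down L (by rw [ass]; omega), ass]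
  · rw [leftOp_down L b1, rightOp_down L b2, map_add, map_smul, map_add, map_smul,
      leftOp_down L b1, rightOp_down L b2]
    rcases b3 with b3 | b3
    · have e := simple_mul_eq_mul_simple cs (w := cs.simple i * w) (i := i) (j := j)
        (by rw [a1]; omega) b3 (by rw [a1]; omega)
      rw [a1] at e
      have e' : w * cs.simple j = cs.simple i * w := by rw [← cs.simple_mul_simple_cancel_right
        (w := cs.simple i * w) j, ← e]
      have hx := xi_eq L (w := cs.simple i * w) (i := i) (j := j) (by rw [a1]; omega)
        (by rw [a1]; exact e)
      rw [rightOp_up L b3, leftOp_up L (by rw [ass]; omega), ass, hx, e']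
    · rw [rightOp_down L b3, leftOp_down L (by rw [ass]; omega), ass]
      simp only [smul_add, smul_smul, mul_comm (xi L i) (xi L j)]
      abel

theorem hecke_rightOp (L : WeightFunction cs Γ) (h : Hecke L) (j : B)
    (x : FreeMod W Γ) : h.1 (rightOp L j x) = rightOp L j (h.1 x) := by
  have : heckeSubalgebra L ≤
      Subalgebra.centralizer (GroupRing Γ) {rightOp L j} := by
    refine Algebra.adjoin_le ?_
    rintro _ ⟨i, rfl⟩
    rw [SetLike.mem_coe, Subalgebra.mem_centralizer_iff]
    rintro _ rfl
    exact leftOp_rightOp L i j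
  have h2 := (Subalgebra.mem_centralizer_iff _).mp (this h.2) _ rfl
  exact (congrArg (fun f : Module.End (GroupRing Γ) (FreeMod W Γ) => f x) h2).symm

/-- Evaluation of an operator of the Hecke algebra at the basis vector `e_1`. -/
noncomputable def evalOne (L : WeightFunction cs Γ) :
    Hecke L →ₗ[GroupRing Γ] (FreeMod W Γ) :=
  (LinearMap.applyₗ (R := GroupRing Γ) (stdBasis W Γ 1)).comp
    (heckeSubalgebra L).val.toLinearMap

theorem evalOne_apply (L : WeightFunction cs Γ) (h : Hecke L) :
    evalOne L h = h.1 (stdBasis W Γ 1) := rfl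

theorem evalOne_mul (L : WeightFunction cs Γ) (h h' : Hecke L) :
    evalOne L (h * h') = h.1 (evalOne L h') := rfl

theorem evalOne_injective (L : WeightFunction cs Γ) : Function.Injective (evalOne L) := by
  rw [injective_iff_map_eq_zero]
  intro h h0
  have key : ∀ (k : ℕ) (w : W), cs.length w = k → h.1 (stdBasis W Γ w) = 0 := by
    intro k
    induction k with
    | zero =>
      intro w hw
      rw [cs.length_eq_zero_iff] at hw
      rw [hw]; exact h0
    | succ k ih =>
      intro w hw
      obtain ⟨j, hj⟩ := cs.exists_rightDescent_of_ne_one (w := w) (by rintro rfl; simp at hw)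
      rw [cs.isRightDescent_iff] at hj
      have := rightOp_up L (i := j) (w := w * cs.simple j) (by simp; omega)
      rw [cs.simple_mul_simple_cancel_right] at this
      rw [← this, hecke_rightOp, ih _ (by omega), map_zero]
  apply Subtype.ext
  refine (stdBasis W Γ).ext fun w => ?_
  exact key _ w rfl

/-- The operator `leftOp` as an element of the Hecke algebra. -/
noncomputable def gen (L : WeightFunction cs Γ) (i : B) : Hecke L :=
  ⟨leftOp L i, Algebra.subset_adjoin ⟨i, rfl⟩⟩

theorem evalOne_word (L : WeightFunction cs Γ) (ω : List B) (hω : cs.IsReduced ω) :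
    evalOne L (ω.map (gen L)).prod = stdBasis W Γ (cs.wordProd ω) := by
  induction ω with
  | nil => rfl
  | cons i ω ih =>
    have h1 : cs.IsReduced ω := by simpa using hω.drop 1
    rw [List.map_cons, List.prod_cons, evalOne_mul, ih h1, cs.wordProd_cons]
    refine leftOp_up L ?_
    have := hω.eq
    rw [cs.wordProd_cons] at this
    rw [this, h1.eq, List.length_cons]

theorem evalOne_surjective (L : WeightFunction cs Γ) : Function.Surjective (evalOne L) := by
  rw [← LinearMap.range_eq_top, eq_top_iff, ← (stdBasis W Γ).span_eq, Submodule.span_le]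
  rintro _ ⟨w, rfl⟩
  obtain ⟨ω, hω, rfl⟩ := cs.exists_isReduced w
  exact ⟨_, evalOne_word L ω hω⟩

/-- The standard `A`-basis `(T_w)` of the Hecke algebra: `T_w` is the element with `T_w e_1 = e_w`. -/
noncomputable def T (L : WeightFunction cs Γ) : Module.Basis W (GroupRing Γ) (Hecke L) :=
  (stdBasis W Γ).map
    (LinearEquiv.ofBijective (evalOne L) ⟨evalOne_injective L, evalOne_surjective L⟩).symm

theorem evalOne_T (L : WeightFunction cs Γ) (w : W) : evalOne L (T L w) = stdBasis W Γ w := by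
  rw [T, Module.Basis.map_apply]
  exact LinearEquiv.apply_symm_apply
    (LinearEquiv.ofBijective (evalOne L) ⟨evalOne_injective L, evalOne_surjective L⟩) _

theorem T_wordProd (L : WeightFunction cs Γ) (ω : List B) (hω : cs.IsReduced ω) :
    T L (cs.wordProd ω) = (ω.map (gen L)).prod :=
  evalOne_injective L (by rw [evalOne_T, evalOne_word L ω hω])

/-- First defining relation: `T_w T_{w'} = T_{ww'}` if `ℓ(ww') = ℓ(w) + ℓ(w')`. -/
theorem T_mul (L : WeightFunction cs Γ) (w w' : W)
    (h : cs.length (w * w') = cs.length w + cs.length w') :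
    T L w * T L w' = T L (w * w') := by
  obtain ⟨ω, hω, rfl⟩ := cs.exists_isReduced w
  obtain ⟨ω', hω', rfl⟩ := cs.exists_isReduced w'
  have : cs.IsReduced (ω ++ ω') := by
    rw [CoxeterSystem.IsReduced, cs.wordProd_append, h, hω.eq, hω'.eq, List.length_append]
  rw [← cs.wordProd_append, T_wordProd L _ hω, T_wordProd L _ hω', T_wordProd L _ this,
    List.map_append, List.prod_append]

theorem T_one (L : WeightFunction cs Γ) : T L 1 = 1 := by
  simpa using T_wordProd L [] (by simp [CoxeterSystem.IsReduced])

/-- Second defining relation: `T_s ^ 2 = 1 + (v ^ L(s) - v ^ (-L(s))) T_s`. -/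
theorem T_simple_sq (L : WeightFunction cs Γ) (i : B) :
    T L (cs.simple i) * T L (cs.simple i) = 1 + xi L i • T L (cs.simple i) := by
  have h1 : T L (cs.simple i) = gen L i := by
    simpa using T_wordProd L [i] (by simp [CoxeterSystem.IsReduced])
  apply evalOne_injective L
  rw [map_add, map_smul, evalOne_mul, evalOne_T, ← T_one, evalOne_T, h1]
  have := leftOp_down L (i := i) (w := cs.simple i) (by simp)
  rw [cs.simple_mul_simple_self] at this
  exact this

theorem T_simple_inv (L : WeightFunction cs Γ) (i : B) :
    T L (cs.simple i) * (T L (cs.simple i) - algebraMap (GroupRing Γ) (Hecke L) (xi L i)) = 1 ∧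
    (T L (cs.simple i) - algebraMap (GroupRing Γ) (Hecke L) (xi L i)) * T L (cs.simple i) = 1 := by
  constructor
  · rw [mul_sub, T_simple_sq, Algebra.smul_def, Algebra.commutes, add_sub_cancel_right]
  · rw [sub_mul, T_simple_sq, Algebra.smul_def, add_sub_cancel_right]

theorem isUnit_T (L : WeightFunction cs Γ) (w : W) : IsUnit (T L w) := by
  obtain ⟨ω, hω, rfl⟩ := cs.exists_isReduced w
  induction ω with
  | nil => simp [T_one]
  | cons i ω ih =>
    have h1 : cs.IsReduced ω := by simpa using hω.drop 1
    have := hω.eq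
    rw [cs.wordProd_cons] at this ⊢
    rw [← T_mul L _ _ (by rw [this, h1.eq, cs.length_simple, List.length_cons, add_comm])]
    exact IsUnit.mul ⟨⟨_, _, (T_simple_inv L i).1, (T_simple_inv L i).2⟩, rfl⟩ (ih h1)

/-- `T_w` as a unit of the Hecke algebra. -/
noncomputable def TUnit (L : WeightFunction cs Γ) (w : W) : (Hecke L)ˣ := (isUnit_T L w).unit

/-- The semilinear involution `∑ a_w T_w ↦ ∑ (barA a_w) T_{w⁻¹}⁻¹` of the Hecke algebra. -/
noncomputable def bar (L : WeightFunction cs Γ) (h : Hecke L) : Hecke L :=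
  ((T L).repr h).sum fun w a => barA a • (((TUnit L w⁻¹)⁻¹ : (Hecke L)ˣ) : Hecke L)

section KL

theorem hecke_induction (L : WeightFunction cs Γ) {P : Hecke L → Prop}
    (hadd : ∀ h h', P h → P h' → P (h + h')) (hT : ∀ (a : GroupRing Γ) (w : W), P (a • T L w)) (h : Hecke L) : P h := by
  rw [← (T L).linearCombination_repr h]
  induction (T L).repr h using Finsupp.induction_linear with
  | zero => simpa using hT 0 1
  | add f g hf hg => rw [map_add]; exact hadd _ _ hf hg
  | single w a => rw [Finsupp.linearCombination_single]; exact hT a w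

theorem bar_add (L : WeightFunction cs Γ) (h h' : Hecke L) :
    bar L (h + h') = bar L h + bar L h' := by
  classical
  rw [bar, map_add, Finsupp.sum_add_index']
  · rfl
  · simp
  · simp [add_smul]

theorem bar_smul (L : WeightFunction cs Γ) (a : GroupRing Γ) (h : Hecke L) :
    bar L (a • h) = barA a • bar L h := by
  rw [bar, map_smul, Finsupp.sum_smul_index' (by simp), bar, Finsupp.smul_sum]
  simp [mul_smul]

theorem bar_T (L : WeightFunction cs Γ) (w : W) :
    bar L (T L w) = (((TUnit L w⁻¹)⁻¹ : (Hecke L)ˣ) : Hecke L) := by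
  rw [bar, Module.Basis.repr_self, Finsupp.sum_single_index (by simp), map_one, one_smul]

theorem bar_zero (L : WeightFunction cs Γ) : bar L 0 = 0 := by simp [bar]

theorem bar_sub (L : WeightFunction cs Γ) (h h' : Hecke L) :
    bar L (h - h') = bar L h - bar L h' := by
  rw [eq_sub_iff_add_eq, ← bar_add, sub_add_cancel]

theorem bar_neg (L : WeightFunction cs Γ) (h : Hecke L) : bar L (-h) = -bar L h := by
  rw [← zero_sub, bar_sub, bar_zero, zero_sub]

theorem barA_xi (L : WeightFunction cs Γ) (i : B) : barA (xi L i) = -xi L i := by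
  rw [xi, map_sub, barA_vpow, barA_vpow, neg_neg, neg_sub]

/-- The inverse of `T_s`. -/
noncomputable def Tsinv (L : WeightFunction cs Γ) (i : B) : Hecke L :=
  T L (cs.simple i) - algebraMap (GroupRing Γ) (Hecke L) (xi L i)

theorem bar_T_mul (L : WeightFunction cs Γ) {i : B} {w : W}
    (h : cs.length (cs.simple i * w) = cs.length w + 1) :
    bar L (T L (cs.simple i * w)) = Tsinv L i * bar L (T L w) := by
  rw [bar_T, bar_T, Units.inv_eq_of_mul_eq_one_right]
  have h1 : ((TUnit L (cs.simple i * w)⁻¹ : (Hecke L)ˣ) : Hecke L) =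
      ((TUnit L w⁻¹ : (Hecke L)ˣ) : Hecke L) * T L (cs.simple i) := by
    change T L _ = T L _ * T L _
    rw [T_mul, mul_inv_rev, cs.inv_simple]
    rw [cs.length_simple, ← cs.length_inv, mul_inv_rev, inv_inv, cs.inv_simple, h, cs.length_inv]
  rw [h1, mul_assoc, ← mul_assoc (T L _), Tsinv, (T_simple_inv L i).1, one_mul, Units.mul_inv]

theorem T_simple_mul_up (L : WeightFunction cs Γ) {i : B} {w : W}
    (h : cs.length (cs.simple i * w) = cs.length w + 1) :
    T L (cs.simple i) * T L w = T L (cs.simple i * w) :=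
  T_mul L _ _ (by rw [h, cs.length_simple, add_comm])

theorem T_simple_mul_down (L : WeightFunction cs Γ) {i : B} {w : W}
    (h : cs.length (cs.simple i * w) + 1 = cs.length w) :
    T L (cs.simple i) * T L w = T L (cs.simple i * w) + xi L i • T L w := by
  have e := T_simple_mul_up L (i := i) (w := cs.simple i * w) (by simpa using h.symm)
  rw [cs.simple_mul_simple_cancel_left] at e
  rw [← e, ← mul_assoc, T_simple_sq, add_mul, one_mul, smul_mul_assoc]

theorem bar_T_simple_mul (L : WeightFunction cs Γ) (i : B) (h : Hecke L) :
    bar L (T L (cs.simple i) * h) = Tsinv L i * bar L h := by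
  induction h using hecke_induction L with
  | hadd h h' e e' => rw [mul_add, bar_add, e, e', bar_add, mul_add]
  | hT a w =>
    rw [mul_smul_comm, bar_smul, bar_smul, mul_smul_comm]
    congr 1
    rcases cs.length_simple_mul w i with h | h
    · rw [T_simple_mul_up L h, bar_T_mul L h]
    · have e := bar_T_mul L (i := i) (w := cs.simple i * w) (by simpa using h.symm)
      rw [cs.simple_mul_simple_cancel_left] at e
      have e2 : T L (cs.simple i) * bar L (T L w) = bar L (T L (cs.simple i * w)) := by
        rw [e, ← mul_assoc, Tsinv, (T_simple_inv L i).1, one_mul]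
      rw [T_simple_mul_down L h, bar_add, bar_smul, barA_xi, Tsinv, sub_mul, e2, neg_smul,
        ← Algebra.smul_def, sub_eq_add_neg]

theorem bar_Tsinv_mul (L : WeightFunction cs Γ) (i : B) (h : Hecke L) :
    bar L (Tsinv L i * h) = T L (cs.simple i) * bar L h := by
  rw [Tsinv, sub_mul, bar_sub, bar_T_simple_mul, ← Algebra.smul_def, bar_smul, barA_xi, Tsinv,
    sub_mul, ← Algebra.smul_def, neg_smul, sub_neg_eq_add, sub_add_cancel]

theorem exists_simple_mul (cs : CoxeterSystem M W) {w : W} (hw : w ≠ 1) :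
    ∃ i u, w = cs.simple i * u ∧ cs.length (cs.simple i * u) = cs.length u + 1 := by
  obtain ⟨i, hi⟩ := cs.exists_leftDescent_of_ne_one hw
  rw [cs.isLeftDescent_iff] at hi
  exact ⟨i, cs.simple i * w, by simp, by simpa using hi.symm⟩

theorem length_induction (cs : CoxeterSystem M W) {P : W → Prop} (h1 : P 1)
    (hs : ∀ i u, cs.length (cs.simple i * u) = cs.length u + 1 → P u → P (cs.simple i * u))
    (w : W) : P w := by
  induction hk : cs.length w generalizing w with
  | zero => rw [cs.length_eq_zero_iff] at hk; rwa [hk]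
  | succ k ih =>
    obtain ⟨i, u, rfl, hu⟩ := exists_simple_mul cs (w := w) (by rintro rfl; simp at hk)
    exact hs i u hu (ih u (by omega))

theorem bar_T_one (L : WeightFunction cs Γ) : bar L (T L 1) = 1 := by
  rw [bar_T, inv_one, Units.inv_eq_of_mul_eq_one_right]
  rw [mul_one]; exact T_one L

theorem bar_bar (L : WeightFunction cs Γ) (h : Hecke L) : bar L (bar L h) = h := by
  induction h using hecke_induction L with
  | hadd h h' e e' => rw [bar_add, bar_add, e, e']
  | hT a w =>
    rw [bar_smul, bar_smul, barA_barA]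
    congr 1
    induction w using length_induction cs with
    | h1 => rw [bar_T_one, ← T_one, bar_T_one, T_one]
    | hs i u hu ih => rw [bar_T_mul L hu, bar_Tsinv_mul, ih, T_simple_mul_up L hu]

/-- The span of the `T_y` with `ℓ(y) < k`. -/
noncomputable def Fil (L : WeightFunction cs Γ) (k : ℕ) : Submodule (GroupRing Γ) (Hecke L) :=
  Submodule.span (GroupRing Γ) (T L '' {y | cs.length y < k})

theorem mem_Fil (L : WeightFunction cs Γ) (k : ℕ) (h : Hecke L) :
    h ∈ Fil L k ↔ ∀ y, (T L).repr h y ≠ 0 → cs.length y < k := by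
  rw [Fil, Module.Basis.mem_span_image]
  simp [Set.subset_def]

theorem T_mem_Fil (L : WeightFunction cs Γ) {k : ℕ} {w : W} (h : cs.length w < k) :
    T L w ∈ Fil L k := Submodule.subset_span ⟨w, h, rfl⟩

theorem Fil_mono (L : WeightFunction cs Γ) {k k' : ℕ} (h : k ≤ k') : Fil L k ≤ Fil L k' :=
  Submodule.span_mono (Set.image_mono fun _ hy => lt_of_lt_of_le hy h)

theorem T_simple_mul_mem (L : WeightFunction cs Γ) (i : B) {k : ℕ} {h : Hecke L}
    (hh : h ∈ Fil L k) : T L (cs.simple i) * h ∈ Fil L (k + 1) := by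
  induction hh using Submodule.span_induction with
  | mem x hx =>
    obtain ⟨y, hy, rfl⟩ := hx
    change cs.length y < k at hy
    rcases cs.length_simple_mul y i with e | e
    · rw [T_simple_mul_up L e]
      exact T_mem_Fil L (by omega)
    · rw [T_simple_mul_down L e]
      exact add_mem (T_mem_Fil L (by omega)) (Submodule.smul_mem _ _ (T_mem_Fil L (by omega)))
  | zero => simp
  | add x y _ _ hx hy => rw [mul_add]; exact add_mem hx hy
  | smul a x _ hx => rw [mul_smul_comm]; exact Submodule.smul_mem _ _ hx

theorem bar_T_sub_mem (L : WeightFunction cs Γ) (w : W) :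
    bar L (T L w) - T L w ∈ Fil L (cs.length w) := by
  induction w using length_induction cs with
  | h1 => rw [bar_T_one, T_one, sub_self]; exact zero_mem _
  | hs i u hu ih =>
    have e : bar L (T L (cs.simple i * u)) - T L (cs.simple i * u) =
        T L (cs.simple i) * (bar L (T L u) - T L u) - xi L i • (bar L (T L u) - T L u)
          - xi L i • T L u := by
      rw [bar_T_mul L hu, ← T_simple_mul_up L hu, Tsinv, sub_mul, ← Algebra.smul_def, mul_sub,
        smul_sub]
      abel
    rw [e, hu]
    exact sub_mem (sub_mem (T_simple_mul_mem L i ih)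
      (Submodule.smul_mem _ _ (Fil_mono L (Nat.le_succ _) ih)))
      (Submodule.smul_mem _ _ (T_mem_Fil L (Nat.lt_succ_self _)))

theorem repr_bar (L : WeightFunction cs Γ) {k : ℕ} {h : Hecke L} (hh : h ∈ Fil L (k + 1))
    (y : W) (hy : cs.length y = k) : (T L).repr (bar L h) y = barA ((T L).repr h y) := by
  induction hh using Submodule.span_induction with
  | mem x hx =>
    obtain ⟨z, hz, rfl⟩ := hx
    change cs.length z < k + 1 at hz
    have e := bar_T_sub_mem L z
    rw [mem_Fil] at e
    have e2 : (T L).repr (bar L (T L z) - T L z) y = 0 := by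
      by_contra h0
      have := e y h0
      omega
    rw [map_sub, Finsupp.sub_apply, sub_eq_zero] at e2
    rw [e2, Module.Basis.repr_self]
    classical
    rw [Finsupp.single_apply]
    split_ifs <;> simp
  | zero => simp [bar_zero]
  | add x z _ _ hx hz => simp [bar_add, hx, hz]
  | smul a x _ hx => simp [bar_smul, hx]

theorem bar_mem_Fil (L : WeightFunction cs Γ) {k : ℕ} {h : Hecke L} (hh : h ∈ Fil L k) :
    bar L h ∈ Fil L k := by
  induction hh using Submodule.span_induction with
  | mem x hx =>
    obtain ⟨z, hz, rfl⟩ := hx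
    rw [← sub_add_cancel (bar L (T L z)) (T L z)]
    exact add_mem (Fil_mono L (le_of_lt hz) (bar_T_sub_mem L z)) (T_mem_Fil L hz)
  | zero => simp [bar_zero]
  | add x y _ _ hx hy => rw [bar_add]; exact add_mem hx hy
  | smul a x _ hx => rw [bar_smul]; exact Submodule.smul_mem _ _ hx

theorem mem_Fil_of_top (L : WeightFunction cs Γ) {k : ℕ} {h : Hecke L} (hh : h ∈ Fil L (k + 1))
    (h0 : ∀ y, cs.length y = k → (T L).repr h y = 0) : h ∈ Fil L k := by
  rw [mem_Fil] at hh ⊢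
  intro y hy
  have h1 := hh y hy
  have h2 : cs.length y ≠ k := fun h => hy (h0 y h)
  omega

theorem exists_mem_Fil (L : WeightFunction cs Γ) (h : Hecke L) : ∃ k, h ∈ Fil L k := by
  refine ⟨((T L).repr h).support.sup cs.length + 1, ?_⟩
  rw [mem_Fil]
  intro y hy
  exact Nat.lt_succ_of_le (Finset.le_sup (f := cs.length) (Finsupp.mem_support_iff.mpr hy))

theorem eq_zero_of_mem_Fil_zero (L : WeightFunction cs Γ) {h : Hecke L} (hh : h ∈ Fil L 0) :
    h = 0 := by
  rw [mem_Fil] at hh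
  apply (T L).ext_elem
  intro y
  by_contra h0
  exact absurd (hh y (by simpa using h0)) (by omega)

theorem eq_zero_of_isNegative [IsOrderedAddMonoid Γ] {c : GroupRing Γ} (h1 : IsNegative c)
    (h2 : barA c = c) : c = 0 := by
  refine groupRing_ext fun γ => ?_
  rw [coeffAt_zero]
  by_contra h0
  have h3 := h1 γ h0
  rw [← h2, coeffAt_barA] at h0
  have h4 := h1 _ h0
  exact lt_asymm h3 (neg_neg_iff_pos.mp h4)

theorem exists_negative_part [IsOrderedAddMonoid Γ] {c : GroupRing Γ} (hc : barA c = -c) :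
    ∃ q : GroupRing Γ, IsNegative q ∧ q - barA q = c ∧ (c = 0 → q = 0) := by
  classical
  let q : GroupRing Γ := AddMonoidAlgebra.ofCoeff
    ((AddMonoidAlgebra.coeff (R := ℤ) c).filter (· < (0 : Γ)))
  have hq : ∀ γ, q.coeffAt γ = if γ < 0 then c.coeffAt γ else 0 := fun γ =>
    Finsupp.filter_apply _ _ _
  refine ⟨q, ?_, ?_, ?_⟩
  · intro γ h
    by_contra h0
    exact h (by rw [hq, if_neg h0])
  · refine groupRing_ext fun γ => ?_
    have h1 : c.coeffAt (-γ) = -c.coeffAt γ := by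
      rw [← coeffAt_barA, hc, coeffAt_neg]
    rw [coeffAt_sub, coeffAt_barA, hq, hq, h1]
    simp only [neg_neg_iff_pos]
    rcases lt_trichotomy γ 0 with h | h | h
    · rw [if_pos h, if_neg (not_lt_of_gt h), sub_zero]
    · subst h
      rw [neg_zero] at h1
      simp; omega
    · rw [if_neg (not_lt_of_gt h), if_pos h, zero_sub, neg_neg]
  · rintro rfl
    refine groupRing_ext fun γ => ?_
    rw [hq, coeffAt_zero]; simp

/-- The two conditions characterising the Kazhdan-Lusztig element `C_w`: it is fixed by the
involution, and it lies in `T_w + ⊕_y A_{< 0} T_y`. -/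
def IsKL (L : WeightFunction cs Γ) (w : W) (C : Hecke L) : Prop :=
  bar L C = C ∧ ∀ y : W, IsNegative ((T L).repr (C - T L w) y)

theorem eq_zero_of_bar_eq [IsOrderedAddMonoid Γ] (L : WeightFunction cs Γ) {h : Hecke L}
    (h1 : bar L h = h) (h2 : ∀ y, IsNegative ((T L).repr h y)) : h = 0 := by
  obtain ⟨k, hk⟩ := exists_mem_Fil L h
  induction k with
  | zero => exact eq_zero_of_mem_Fil_zero L hk
  | succ k ih =>
    refine ih (mem_Fil_of_top L hk fun y hy => eq_zero_of_isNegative (h2 y) ?_)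
    rw [← repr_bar L hk y hy, h1]

theorem isNegative_add {a b : GroupRing Γ} (ha : IsNegative a) (hb : IsNegative b) :
    IsNegative (a + b) := by
  intro γ h
  by_contra h0
  have h1 : a.coeffAt γ = 0 := by by_contra h; exact h0 (ha γ h)
  have h2 : b.coeffAt γ = 0 := by by_contra h; exact h0 (hb γ h)
  exact h (by rw [coeffAt_add, h1, h2, add_zero])

theorem isNegative_sub {a b : GroupRing Γ} (ha : IsNegative a) (hb : IsNegative b) :
    IsNegative (a - b) := by
  rw [sub_eq_add_neg]
  refine isNegative_add ha fun γ h => hb γ ?_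
  rwa [coeffAt_neg, neg_ne_zero] at h

theorem exists_sub_bar [IsOrderedAddMonoid Γ] (L : WeightFunction cs Γ) (k : ℕ) :
    ∀ h : Hecke L, h ∈ Fil L k → bar L h = -h →
      ∃ g : Hecke L, (∀ y, IsNegative ((T L).repr g y)) ∧ g - bar L g = h := by
  classical
  induction k with
  | zero =>
    intro h hh _
    rw [eq_zero_of_mem_Fil_zero L hh]
    exact ⟨0, fun y γ h => absurd (by simp [coeffAt_zero]) h, by simp [bar_zero]⟩
  | succ k ih =>
    intro h hh hb
    have hc : ∀ y, cs.length y = k → barA ((T L).repr h y) = -(T L).repr h y := by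
      intro y hy
      rw [← repr_bar L hh y hy, hb]; simp
    have hq : ∀ y, ∃ q : GroupRing Γ, IsNegative q ∧
        (cs.length y = k → q - barA q = (T L).repr h y) ∧
        (q ≠ 0 → cs.length y = k ∧ (T L).repr h y ≠ 0) := by
      intro y
      by_cases hy : cs.length y = k
      · obtain ⟨q, h1, h2, h3⟩ := exists_negative_part (hc y hy)
        exact ⟨q, h1, fun _ => h2, fun h => ⟨hy, fun h' => h (h3 h')⟩⟩
      · exact ⟨0, fun γ h => absurd (coeffAt_zero γ) h, fun h => absurd h hy,
          fun h => absurd rfl h⟩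
    choose q q1 q2 q3 using hq
    let f : W →₀ GroupRing Γ := Finsupp.onFinset ((T L).repr h).support q
      fun y hy => Finsupp.mem_support_iff.mpr (q3 y hy).2
    let g₀ : Hecke L := (T L).repr.symm f
    have hg₀ : ∀ y, (T L).repr g₀ y = q y := by
      intro y
      simp [g₀, f]
    have mg : g₀ ∈ Fil L (k + 1) := by
      rw [mem_Fil]
      intro y hy
      rw [hg₀] at hy
      have := (q3 y hy).1
      omega
    obtain ⟨g, g1, g2⟩ := ih (h - (g₀ - bar L g₀))
      (by
        refine mem_Fil_of_top L (sub_mem hh (sub_mem mg (bar_mem_Fil L mg))) ?_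
        intro y hy
        rw [map_sub, map_sub, Finsupp.sub_apply, Finsupp.sub_apply, repr_bar L mg y hy, hg₀,
          q2 y hy, sub_self])
      (by rw [bar_sub, bar_sub, bar_bar, hb]; abel)
    refine ⟨g₀ + g, ?_, ?_⟩
    · intro y
      rw [map_add, Finsupp.add_apply, hg₀]
      exact isNegative_add (q1 y) (g1 y)
    · rw [bar_add]
      calc g₀ + g - (bar L g₀ + bar L g) = (g - bar L g) + (g₀ - bar L g₀) := by abel
        _ = h := by rw [g2]; abel

/-- For every `w` there is exactly one element with the defining properties of `C_w`. -/
theorem existsUnique_isKL [IsOrderedAddMonoid Γ] (L : WeightFunction cs Γ) (w : W) :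
    ∃! C : Hecke L, IsKL L w C := by
  obtain ⟨g, g1, g2⟩ := exists_sub_bar L _ _ (bar_T_sub_mem L w)
    (by rw [bar_sub, bar_bar]; abel)
  refine ⟨T L w + g, ⟨?_, ?_⟩, ?_⟩
  · rw [bar_add]
    calc bar L (T L w) + bar L g = T L w + g + ((bar L (T L w) - T L w) - (g - bar L g)) := by abel
      _ = T L w + g := by rw [g2]; abel
  · intro y
    rw [add_sub_cancel_left]
    exact g1 y
  · rintro C ⟨c1, c2⟩
    have hb : bar L (T L w + g) = T L w + g := by
      rw [bar_add]
      calc bar L (T L w) + bar L g = T L w + g + ((bar L (T L w) - T L w) - (g - bar L g)) := by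
            abel
        _ = T L w + g := by rw [g2]; abel
    rw [← sub_eq_zero]
    refine eq_zero_of_bar_eq L (by rw [bar_sub, c1, hb]) fun y => ?_
    rw [← sub_sub, map_sub, Finsupp.sub_apply]
    exact isNegative_sub (c2 y) (g1 y)

/-- The Kazhdan-Lusztig basis element `C_w`, the unique element satisfying `IsKL L w`. -/
noncomputable def KLelt [IsOrderedAddMonoid Γ] (L : WeightFunction cs Γ) (w : W) : Hecke L :=
  (existsUnique_isKL L w).choose

/-- The canonical symmetrizing form: the `A`-linear map with `τ(T_w) = δ_{1,w}`. -/
noncomputable def tau (L : WeightFunction cs Γ) : Hecke L →ₗ[GroupRing Γ] GroupRing Γ :=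
  (T L).coord 1

end KL

end Hecke

section Longest

variable {B W : Type*} [Group W] {M : CoxeterMatrix B}

/-- `w` is an element of maximal length of the subgroup `H`. -/
def IsLongestIn (cs : CoxeterSystem M W) (H : Subgroup W) (w : W) : Prop :=
  w ∈ H ∧ ∀ u ∈ H, cs.length u ≤ cs.length w

theorem exists_isLongestIn (cs : CoxeterSystem M W) (H : Subgroup W) (N : ℕ)
    (h : ∀ u ∈ H, cs.length u ≤ N) : ∃ w, IsLongestIn cs H w := by
  have hne : (cs.length '' (H : Set W)).Nonempty := ⟨_, 1, H.one_mem, rfl⟩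
  have hb : BddAbove (cs.length '' (H : Set W)) := ⟨N, by rintro _ ⟨u, hu, rfl⟩; exact h u hu⟩
  obtain ⟨w, hw, hw'⟩ := Nat.sSup_mem hne hb
  exact ⟨w, hw, fun u hu => by rw [hw']; exact le_csSup hb ⟨u, hu, rfl⟩⟩

end Longest

section TypeB

/-- The Coxeter matrix of type `B_n`, with the nodes numbered from the double bond: node `0` is `t`
and node `k ≥ 1` is `s_k`. -/
def matB (n : ℕ) : CoxeterMatrix (Fin n) := (CoxeterMatrix.B n).reindex Fin.revPerm

theorem matB_apply (n : ℕ) (i j : Fin n) : matB n i j =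
    if i = j then 1
    else if (i : ℕ) + j = 1 then 4
    else if (i : ℕ) + 1 = j ∨ (j : ℕ) + 1 = i then 3 else 2 := by
  have hi := i.isLt
  have hj := j.isLt
  rw [matB, CoxeterMatrix.reindex_apply]
  simp only [CoxeterMatrix.B, Matrix.of_apply, Fin.revPerm_symm, Fin.revPerm_apply, Fin.ext_iff,
    Fin.val_rev]
  split_ifs <;> omega

/-- The Coxeter group `W_n` of type `B_n`. -/
abbrev WB (n : ℕ) : Type := (matB n).Group

/-- The Coxeter system `(W_n, S_n)`. -/
def csB (n : ℕ) : CoxeterSystem (matB n) (WB n) := (matB n).toCoxeterSystem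

/-- The number `ℓ_t(w)` of occurrences of `t` in a reduced expression of `w`. -/
noncomputable def ellT (n : ℕ) (w : WB n) : ℕ :=
  ((csB n).exists_isReduced w).choose.countP fun i => i.val = 0

/-- The number `ℓ_s(w) = ℓ(w) - ℓ_t(w)`. -/
noncomputable def ellS (n : ℕ) (w : WB n) : ℤ := (csB n).length w - ellT n w

theorem signB_isLiftable (n : ℕ) :
    (matB n).IsLiftable (fun i : Fin n => if i.val = 0 then (-1 : ℤˣ) else 1) := by
  intro i j
  have h4 : ((-1 : ℤˣ)) ^ 4 = 1 := by decide
  have h2 : ((-1 : ℤˣ)) ^ 2 = 1 := by decide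
  rw [matB_apply]
  simp only [Fin.ext_iff]
  by_cases hi : i.val = 0 <;> by_cases hj : j.val = 0
  · simp [hi, hj]
  · rw [if_pos hi, if_neg hj]
    split_ifs <;> first | (exfalso; omega) | simp [h4, h2]
  · rw [if_neg hi, if_pos hj]
    split_ifs <;> first | (exfalso; omega) | simp [h4, h2]
  · simp [hi, hj]

/-- The sign character of `W_n` with `t ↦ -1` and `s_k ↦ 1`. -/
noncomputable def signB (n : ℕ) : WB n →* ℤˣ := (csB n).lift ⟨_, signB_isLiftable n⟩

theorem countP_rightInvSeq (n : ℕ) (ω : List (Fin n)) :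
    ((csB n).rightInvSeq ω).countP (fun r => signB n r = -1) = ω.countP fun i => i.val = 0 := by
  induction ω with
  | nil => rfl
  | cons i ω ih =>
    have h1 : signB n (((csB n).wordProd ω)⁻¹ * (csB n).simple i * (csB n).wordProd ω) =
        if i.val = 0 then (-1 : ℤˣ) else 1 := by
      have h2 : signB n ((csB n).simple i) = if i.val = 0 then (-1 : ℤˣ) else 1 :=
        (csB n).lift_apply_simple (signB_isLiftable n) i
      rw [map_mul, map_mul, map_inv, mul_right_comm, inv_mul_cancel, one_mul, h2]
    have h3 : ((if i.val = 0 then (-1 : ℤˣ) else 1) = -1) ↔ i.val = 0 := by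
      split_ifs with h
      · simp [h]
      · simp only [h, iff_false]; decide
    rw [CoxeterSystem.rightInvSeq, List.countP_cons, List.countP_cons, ih, h1]
    simp only [h3]

theorem ellT_wordProd (n : ℕ) (ω : List (Fin n)) (hω : (csB n).IsReduced ω) :
    ellT n ((csB n).wordProd ω) = ω.countP fun i => i.val = 0 := by
  obtain ⟨h1, h2⟩ := ((csB n).exists_isReduced ((csB n).wordProd ω)).choose_spec
  rw [ellT, ← countP_rightInvSeq, ← countP_rightInvSeq]
  exact (rightInvSeq_perm (csB n) h1 hω h2.symm).countP_eq _

theorem ellT_mul (n : ℕ) (w w' : WB n)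
    (h : (csB n).length (w * w') = (csB n).length w + (csB n).length w') :
    ellT n (w * w') = ellT n w + ellT n w' := by
  obtain ⟨ω, hω, rfl⟩ := (csB n).exists_isReduced w
  obtain ⟨ω', hω', rfl⟩ := (csB n).exists_isReduced w'
  have : (csB n).IsReduced (ω ++ ω') := by
    rw [CoxeterSystem.IsReduced, (csB n).wordProd_append, h, hω.eq, hω'.eq, List.length_append]
  rw [← (csB n).wordProd_append, ellT_wordProd n _ this, ellT_wordProd n _ hω, ellT_wordProd n _ hω',
    List.countP_append]

theorem ellT_simple (n : ℕ) (i : Fin n) :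
    ellT n ((csB n).simple i) = if i.val = 0 then 1 else 0 := by
  have := ellT_wordProd n [i] (by simp [CoxeterSystem.IsReduced])
  simpa [List.countP_cons] using this

/-- The weight function `L_n(w) = (ℓ_t(w), ℓ_s(w))` with values in `ℤ²`, ordered
lexicographically. -/
noncomputable def LB (n : ℕ) : WeightFunction (csB n) (ℤ ×ₗ ℤ) where
  toFun w := toLex ((ellT n w : ℤ), ellS n w)
  map_mul' w w' h := by
    rw [← toLex_add, Prod.mk_add_mk, ellS, ellS, ellS, h, ellT_mul n w w' h]
    push_cast
    congr 2
    ring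
  pos' i := by
    rw [ellS, ellT_simple, (csB n).length_simple, Prod.Lex.lt_iff]
    by_cases h : i.val = 0 <;> simp [h]

/-- The Hecke algebra `H_n` of type `B_n`, over `A = ℤ[V, V⁻¹, v, v⁻¹]`. -/
abbrev HB (n : ℕ) : Type := Hecke (LB n)

/-- The power `V ^ k` of `V = v ^ (1, 0)`. -/
noncomputable def Vpow (k : ℤ) : GroupRing (ℤ ×ₗ ℤ) := vpow (toLex (k, 0))

/-- The generators: `sB n 0 = t` and `sB n k = s_k` for `1 ≤ k ≤ n - 1` (and `1` for `k ≥ n`, which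
is never used). -/
noncomputable def sB (n k : ℕ) : WB n := if h : k < n then (csB n).simple ⟨k, h⟩ else 1

/-- `r_1 = t` and `r_{i+1} = s_i r_i`. -/
noncomputable def rB (n : ℕ) : ℕ → WB n
  | 0 => 1
  | 1 => sB n 0
  | i + 2 => sB n (i + 1) * rB n (i + 1)

/-- `t_1 = t` and `t_{i+1} = s_i t_i s_i`. -/
noncomputable def tB (n : ℕ) : ℕ → WB n
  | 0 => 1
  | 1 => sB n 0
  | i + 2 => sB n (i + 1) * tB n (i + 1) * sB n (i + 1)

/-- `a_l = r_1 r_2 ⋯ r_l`. -/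
noncomputable def aB (n l : ℕ) : WB n := ((List.range l).map fun i => rB n (i + 1)).prod

/-- The parabolic subgroup `𝔖_l` of `W_n`, generated by `s_1, …, s_{l-1}`. -/
def symB (n l : ℕ) : Subgroup (WB n) :=
  Subgroup.closure {w | ∃ k : Fin n, 1 ≤ k.val ∧ k.val < l ∧ w = (csB n).simple k}

theorem sB_sq (n k : ℕ) : sB n k * sB n k = 1 := by
  rw [sB]; split_ifs <;> simp

theorem sB_comm (n i k : ℕ) (h : i + 2 ≤ k) (hk : k < n) (hi : 1 ≤ i) :
    sB n i * sB n k = sB n k * sB n i := by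
  have h1 := (csB n).simple_mul_simple_pow ⟨i, by omega⟩ ⟨k, hk⟩
  rw [matB_apply, if_neg (by simp; omega), if_neg (by simp; omega), if_neg (by simp; omega)] at h1
  rw [sB, dif_pos (by omega : i < n), sB, dif_pos hk]
  rw [pow_two, mul_eq_one_iff_eq_inv, mul_inv_rev, (csB n).inv_simple, (csB n).inv_simple] at h1
  exact h1

theorem sB_braid (n i : ℕ) (hi : 1 ≤ i) (hk : i + 1 < n) :
    sB n (i + 1) * sB n i * sB n (i + 1) = sB n i * sB n (i + 1) * sB n i := by
  have h1 := (csB n).simple_mul_simple_pow ⟨i + 1, hk⟩ ⟨i, by omega⟩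
  rw [matB_apply, if_neg (by simp), if_neg (by simp; omega), if_pos (by simp)] at h1
  rw [sB, dif_pos hk, sB, dif_pos (by omega : i < n)]
  have h2 : (csB n).simple ⟨i + 1, hk⟩ * (csB n).simple ⟨i, by omega⟩ *
      (csB n).simple ⟨i + 1, hk⟩ * ((csB n).simple ⟨i, by omega⟩ *
      (csB n).simple ⟨i + 1, hk⟩ * (csB n).simple ⟨i, by omega⟩) = 1 := by
    rw [← h1, pow_succ, pow_two]
    simp only [mul_assoc]
  rw [mul_eq_one_iff_eq_inv] at h2
  rw [h2]
  simp [mul_assoc]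

/-- `s_l s_{l-1} ⋯ s_{l-j+1}`. -/
noncomputable def cosetB (n l : ℕ) : ℕ → WB n
  | 0 => 1
  | j + 1 => cosetB n l j * sB n (l - j)

theorem cosetB_comm (n l i j : ℕ) (hl : l < n) (hi : 1 ≤ i) (h : i + j < l) :
    cosetB n l j * sB n i = sB n i * cosetB n l j := by
  induction j with
  | zero => simp [cosetB]
  | succ j ih =>
    rw [cosetB, mul_assoc, ← sB_comm n i (l - j) (by omega) (by omega) hi, ← mul_assoc,
      ih (by omega), mul_assoc]

theorem cosetB_braid (n l i j : ℕ) (hl : l < n) (hj : j ≤ l) (hi : i + 1 ≤ l) (h : l < i + j) :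
    cosetB n l j * sB n (i + 1) = sB n i * cosetB n l j := by
  induction j with
  | zero => omega
  | succ j ih =>
    by_cases h1 : l < i + j
    · rw [cosetB, mul_assoc, sB_comm n (l - j) (i + 1) (by omega) (by omega) (by omega),
        ← mul_assoc, ih (by omega) h1, mul_assoc]
    · obtain ⟨j, rfl⟩ : ∃ k, j = k + 1 := ⟨j - 1, by omega⟩
      rw [cosetB, cosetB]
      have e1 : l - (j + 1) = i := by omega
      have e2 : l - j = i + 1 := by omega
      rw [e1, e2, mul_assoc, mul_assoc, ← mul_assoc (sB n (i + 1)), sB_braid n i (by omega)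
        (by omega), mul_assoc (sB n i), ← mul_assoc, cosetB_comm n l i j hl (by omega) (by omega)]
      simp only [mul_assoc]

theorem sB_mem (n l k : ℕ) (hk : 1 ≤ k) (hkl : k < l) (hn : k < n) : sB n k ∈ symB n l :=
  Subgroup.subset_closure ⟨⟨k, hn⟩, hk, hkl, by rw [sB, dif_pos hn]⟩

theorem symB_coset (n l : ℕ) (hl : l < n) (w : WB n) (hw : w ∈ symB n (l + 1)) :
    ∃ u ∈ symB n l, ∃ j ≤ l, w = u * cosetB n l j := by
  have step : ∀ (x y : WB n), y ∈ {w | ∃ k : Fin n, 1 ≤ k.val ∧ k.val < l + 1 ∧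
      w = (csB n).simple k} → (∃ u ∈ symB n l, ∃ j ≤ l, x = u * cosetB n l j) →
      ∃ u ∈ symB n l, ∃ j ≤ l, x * y = u * cosetB n l j := by
    rintro _ _ ⟨k, hk1, hk2, rfl⟩ ⟨u, hu, j, hj, rfl⟩
    have hs : (csB n).simple k = sB n k.val := by rw [sB, dif_pos k.isLt]
    rw [hs, mul_assoc]
    rcases lt_trichotomy (k.val + j) l with h | h | h
    · exact ⟨u * sB n k, mul_mem hu (sB_mem n l k hk1 (by omega) k.isLt), j, hj, by
        rw [cosetB_comm n l k j hl hk1 h, mul_assoc]⟩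
    · exact ⟨u, hu, j + 1, by omega, by rw [cosetB, show l - j = k.val by omega]⟩
    · obtain ⟨j, rfl⟩ : ∃ i, j = i + 1 := ⟨j - 1, by omega⟩
      by_cases h1 : k.val + j = l
      · exact ⟨u, hu, j, by omega, by
          rw [cosetB, show l - j = k.val by omega, mul_assoc, sB_sq, mul_one]⟩
      · obtain ⟨k', hk'⟩ : ∃ i, k.val = i + 1 := ⟨k.val - 1, by omega⟩
        refine ⟨u * sB n k', mul_mem hu (sB_mem n l k' (by omega) (by omega) (by omega)), j + 1,
          hj, ?_⟩
        rw [hk', cosetB_braid n l k' (j + 1) hl hj (by omega) (by omega), mul_assoc]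
  induction hw using Subgroup.closure_induction_right with
  | one => exact ⟨1, one_mem _, 0, by omega, by simp [cosetB]⟩
  | mul_right x _ y hy ih => exact step x y hy ih
  | mul_inv_cancel x _ y hy ih =>
    refine step x y⁻¹ ?_ ih
    obtain ⟨k, h1, h2, rfl⟩ := hy
    exact ⟨k, h1, h2, (csB n).inv_simple k⟩

theorem symB_bounded (n l : ℕ) : ∃ N, ∀ u ∈ symB n l, (csB n).length u ≤ N := by
  induction l with
  | zero =>
    refine ⟨0, fun u hu => ?_⟩
    rw [symB] at hu
    simp at hu
    simp [hu]
  | succ l ih =>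
    obtain ⟨N, hN⟩ := ih
    by_cases hl : l < n
    · refine ⟨N + ∑ j ∈ Finset.range (l + 1), (csB n).length (cosetB n l j), fun w hw => ?_⟩
      obtain ⟨u, hu, j, hj, rfl⟩ := symB_coset n l hl w hw
      refine ((csB n).length_mul_le _ _).trans (add_le_add (hN u hu) ?_)
      exact Finset.single_le_sum (f := fun j => (csB n).length (cosetB n l j))
        (fun _ _ => Nat.zero_le _) (Finset.mem_range.mpr (by omega))
    · refine ⟨N, fun u hu => hN u ?_⟩
      refine Subgroup.closure_mono ?_ hu
      rintro _ ⟨k, h1, h2, rfl⟩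
      have := k.isLt
      exact ⟨k, h1, by omega, rfl⟩

theorem exists_longest_symB (n l : ℕ) : ∃ w, IsLongestIn (csB n) (symB n l) w :=
  (symB_bounded n l).elim fun N hN => exists_isLongestIn _ _ N hN

/-- The longest element `σ_l` of `𝔖_l`. -/
noncomputable def sigmaB (n l : ℕ) : WB n := (exists_longest_symB n l).choose

/-- `P_l = (T_{t_1} + V⁻¹) (T_{t_2} + V⁻¹) ⋯ (T_{t_l} + V⁻¹)`. -/
noncomputable def PB (n l : ℕ) : HB n :=
  ((List.range l).map fun i =>
    T (LB n) (tB n (i + 1)) + algebraMap (GroupRing (ℤ ×ₗ ℤ)) (HB n) (Vpow (-1))).prod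

/-- The Kazhdan-Lusztig basis element `C_w` of `H_n`. -/
noncomputable def CB (n : ℕ) (w : WB n) : HB n := KLelt (LB n) w

/-- The inverse `T_w⁻¹` in `H_n`. -/
noncomputable def TinvB (n : ℕ) (w : WB n) : HB n := (((TUnit (LB n) w)⁻¹ : (HB n)ˣ) : HB n)

end TypeB

end CoxeterKL

/-!
Write `D_l = T_{s_l}⁻¹ ⋯ T_{s_1}⁻¹`. Since `T_{t_{l+1}}` commutes with `T_{σ_l}` and
`T_{t_{l+1}} D_l = T_{r_{l+1}}`, the products `E_l = P_l T_{σ_l}⁻¹` satisfy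
`E_{l+1} = E_l (T_{r_{l+1}} + V⁻¹ D_l)`.

* `E_l` is bar-invariant: the second factor minus its bar-conjugate is
  `(T_{s_l} ⋯ T_{s_1} - D_l) (T_t - V)`. Expanding `T_{s_l} ⋯ T_{s_1} - D_l` by the quadratic
  relations and moving `T_t - V` to the left, it is killed by `P_l` since `P_l (T_t - V) = 0`.
* `E_l - T_{a_l}` has coefficients of `V`-degree at most `-1`: right multiplication by
  `T_{r_{l+1}}` is length additive on the parabolic subgroup of type `B_l`, and multiplication by
  the `T_{s_k}⁻¹` does not raise the `V`-degree.

The two facts give `C_{a_l} = E_l`. In the order on `Γ` a coefficient of negative `V`-degree stays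
negative when multiplied by elements of `A` of nonpositive degree, or by powers of `v^{(0,1)}`,
so `C_{a_l} C_σ` is again triangular. For the trace, `P_l T_{t_{l+1}}` is supported
off `𝔖_n`, so each factor `T_{t_i} + V⁻¹` contributes exactly `V⁻¹`.
-/

namespace CoxeterKL

section Parabolic

variable {B W : Type*} [Group W] {M : CoxeterMatrix B} (cs : CoxeterSystem M W)

/-- The standard parabolic subgroup `W_J` generated by the simple reflections indexed by `J`. -/
def parabolic (J : Set B) : Subgroup W := Subgroup.closure (cs.simple '' J)

theorem simple_mem_parabolic {J : Set B} {i : B} (hi : i ∈ J) : cs.simple i ∈ parabolic cs J :=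
  Subgroup.subset_closure (Set.mem_image_of_mem _ hi)

theorem parabolic_mono {J K : Set B} (h : J ⊆ K) : parabolic cs J ≤ parabolic cs K :=
  Subgroup.closure_mono (Set.image_mono h)

@[elab_as_elim]
theorem parabolic_induction {J : Set B} {p : (w : W) → w ∈ parabolic cs J → Prop}
    (one : p 1 (one_mem _))
    (mul_simple : ∀ w hw i (hi : i ∈ J), p w hw →
      p (w * cs.simple i) (mul_mem hw (simple_mem_parabolic cs hi)))
    {w : W} (hw : w ∈ parabolic cs J) : p w hw := by
  induction hw using Subgroup.closure_induction_right with
  | one => exact one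
  | mul_right w hw _ hs ih =>
    obtain ⟨i, hi, rfl⟩ := hs
    exact mul_simple w hw i hi ih
  | mul_inv_cancel w hw _ hs ih =>
    obtain ⟨i, hi, rfl⟩ := hs
    simpa only [cs.inv_simple] using mul_simple w hw i hi ih

theorem rightInvSeq_append (ω ψ : List B) :
    cs.rightInvSeq (ω ++ ψ) =
      (cs.rightInvSeq ω).map (fun r => (cs.wordProd ψ)⁻¹ * r * cs.wordProd ψ) ++
        cs.rightInvSeq ψ := by
  induction ω with
  | nil => simp
  | cons i ω ih =>
    rw [List.cons_append, CoxeterSystem.rightInvSeq, CoxeterSystem.rightInvSeq, ih, List.map_cons,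
      List.cons_append, cs.wordProd_append]
    congr 1
    group

open Classical in
theorem count_rightInvSeq_le {ω ψ : List B} (h : cs.wordProd ω = cs.wordProd ψ)
    (hω : (cs.rightInvSeq ω).Nodup) (r : W) :
    (cs.rightInvSeq ω).count r ≤ (cs.rightInvSeq ψ).count r := by
  have hle := List.nodup_iff_count_le_one.mp hω r
  have hparity := count_rightInvSeq_congr cs h r
  rw [ZMod.natCast_eq_natCast_iff'] at hparity
  omega

theorem rightInvSeq_subperm {ω ψ : List B} (h : cs.wordProd ω = cs.wordProd ψ)
    (hω : (cs.rightInvSeq ω).Nodup) : (cs.rightInvSeq ω).Subperm (cs.rightInvSeq ψ) := by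
  classical
  exact List.subperm_iff_count.mpr (count_rightInvSeq_le cs h hω)

theorem isReduced_of_nodup_rightInvSeq {ω : List B} (h : (cs.rightInvSeq ω).Nodup) :
    cs.IsReduced ω := by
  obtain ⟨ψ, hψ, e⟩ := cs.exists_isReduced (cs.wordProd ω)
  have hle := (rightInvSeq_subperm cs e h).length_le
  rw [cs.length_rightInvSeq, cs.length_rightInvSeq, ← hψ.eq, ← e] at hle
  exact (cs.length_wordProd_le ω).antisymm hle

theorem exists_word_rightInvSeq_subset_parabolic {J : Set B} {w : W} (hw : w ∈ parabolic cs J) :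
    ∃ ψ, w = cs.wordProd ψ ∧ ∀ r ∈ cs.rightInvSeq ψ, r ∈ parabolic cs J := by
  induction hw using parabolic_induction with
  | one => exact ⟨[], by simp, by simp⟩
  | mul_simple _ _ i hi ih =>
    obtain ⟨ψ, rfl, h⟩ := ih
    have hs := simple_mem_parabolic cs hi
    refine ⟨ψ ++ [i], by simp [cs.wordProd_append], fun r hr => ?_⟩
    rw [rightInvSeq_append, cs.wordProd_singleton, cs.rightInvSeq_singleton, List.mem_append,
      List.mem_map, List.mem_singleton] at hr
    obtain ⟨q, hq, rfl⟩ | rfl := hr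
    · exact mul_mem (mul_mem (inv_mem hs) (h q hq)) hs
    · exact hs

theorem mem_parabolic_of_mem_rightInvSeq {J : Set B} {ω : List B} (hω : cs.IsReduced ω)
    (h : cs.wordProd ω ∈ parabolic cs J) {r : W} (hr : r ∈ cs.rightInvSeq ω) :
    r ∈ parabolic cs J := by
  obtain ⟨ψ, e, hψ⟩ := exists_word_rightInvSeq_subset_parabolic cs h
  exact hψ r ((rightInvSeq_subperm cs e hω.nodup_rightInvSeq).subset hr)

theorem length_mul_of_forall_length_le {J : Set B} {y d : W} (hy : y ∈ parabolic cs J)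
    (hd : ∀ u ∈ parabolic cs J, cs.length d ≤ cs.length (u * d)) :
    cs.length (y * d) = cs.length y + cs.length d := by
  obtain ⟨ω, hω, rfl⟩ := cs.exists_isReduced y
  obtain ⟨ψ, hψ, rfl⟩ := cs.exists_isReduced d
  have hdisjoint : ∀ q ∈ cs.rightInvSeq ω,
      (cs.wordProd ψ)⁻¹ * q * cs.wordProd ψ ∉ cs.rightInvSeq ψ := by
    intro q hq hr
    have hlt := (cs.isRightInversion_of_mem_rightInvSeq hψ hr).2
    rw [mul_assoc, mul_inv_cancel_left] at hlt
    exact hlt.not_ge (hd q (mem_parabolic_of_mem_rightInvSeq cs hω hy hq))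
  have hred : cs.IsReduced (ω ++ ψ) := by
    apply isReduced_of_nodup_rightInvSeq
    rw [rightInvSeq_append, List.nodup_append']
    refine ⟨hω.nodup_rightInvSeq.map fun a b h => by simpa using h, hψ.nodup_rightInvSeq, ?_⟩
    rintro _ hmap hr
    obtain ⟨q, hq, rfl⟩ := List.mem_map.mp hmap
    exact hdisjoint q hq hr
  rw [← cs.wordProd_append, hred.eq, hω.eq, hψ.eq, List.length_append]

theorem length_mul_of_forall_le {J : Set B} {y d : W} {m : ℕ} (hy : y ∈ parabolic cs J)
    (hd : cs.length d ≤ m) (hm : ∀ u ∈ parabolic cs J, m ≤ cs.length (u * d)) :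
    cs.length (y * d) = cs.length y + m := by
  have hlen : cs.length d = m := hd.antisymm (by simpa using hm 1 (one_mem _))
  rw [length_mul_of_forall_length_le cs hy (by rwa [hlen]), hlen]

theorem length_mul_of_forall_le_right {J : Set B} {y d : W} {m : ℕ} (hy : y ∈ parabolic cs J)
    (hd : cs.length d ≤ m) (hm : ∀ u ∈ parabolic cs J, m ≤ cs.length (d * u)) :
    cs.length (d * y) = m + cs.length y := by
  rw [← cs.length_inv, mul_inv_rev, ← cs.length_inv y, add_comm]
  refine length_mul_of_forall_le cs (inv_mem hy) (by rwa [cs.length_inv]) fun u hu => ?_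
  rw [← cs.length_inv, mul_inv_rev, inv_inv]
  exact hm u⁻¹ (inv_mem hu)

end Parabolic

section SignedPermutations

/-- The action on `ℤ` of the `k`-th generator of a group of type `B` by signed permutations. The
signed integer `-i` is encoded as `1 - i`, so that `…, 2, 1, -1, -2, …` are consecutive integers,
negation becomes `x ↦ 1 - x`, and `t` (the case `k = 0`) exchanges `0` and `1`. -/
def signedStep (k : ℕ) (x : ℤ) : ℤ :=
  if x = k then k + 1 else if x = k + 1 then k
  else if x = -k then -k + 1 else if x = -k + 1 then -k else x

theorem signedStep_involutive (k : ℕ) : Function.Involutive (signedStep k) := fun x => by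
  grind [signedStep]

theorem signedStep_comm {i j : ℕ} (h : i + 2 ≤ j) (x : ℤ) :
    signedStep i (signedStep j x) = signedStep j (signedStep i x) := by
  grind (splits := 30) [signedStep]

theorem signedStep_braid {i : ℕ} (h : 1 ≤ i) (x : ℤ) :
    signedStep i (signedStep (i + 1) (signedStep i x)) =
      signedStep (i + 1) (signedStep i (signedStep (i + 1) x)) := by
  grind (splits := 30) [signedStep]

theorem signedStep_braid_zero (x : ℤ) :
    signedStep 0 (signedStep 1 (signedStep 0 (signedStep 1 x))) =
      signedStep 1 (signedStep 0 (signedStep 1 (signedStep 0 x))) := by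
  grind (splits := 30) [signedStep]

theorem abs_signedStep_sub_le (k : ℕ) (x : ℤ) : |signedStep k x - x| ≤ 1 := by
  grind [signedStep]

theorem max_signedStep_le (k : ℕ) (x : ℤ) :
    max (signedStep k x) 0 ≤ max x 0 + if x = k then 1 else 0 := by
  grind [signedStep]

theorem signedStep_nonpos_iff {k : ℕ} (hk : 1 ≤ k) (x : ℤ) : signedStep k x ≤ 0 ↔ x ≤ 0 := by
  grind [signedStep]

theorem signedStep_eq_self {k : ℕ} {x : ℤ} (h : (k : ℤ) + 1 < x ∨ x < -k) :
    signedStep k x = x := by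
  grind [signedStep]

/-- The signed permutation `signedStep k` as an element of the group of permutations of `ℤ`. -/
def signedPerm (k : ℕ) : Equiv.Perm ℤ := (signedStep_involutive k).toPerm

theorem signedPerm_apply (k : ℕ) (x : ℤ) : signedPerm k x = signedStep k x := rfl

theorem signedPerm_inv (k : ℕ) : (signedPerm k)⁻¹ = signedPerm k :=
  (signedStep_involutive k).toPerm_symm

theorem signedPerm_mul_pow_two {i j : ℕ} (h : i + 2 ≤ j) :
    (signedPerm i * signedPerm j) ^ 2 = 1 := by
  ext x
  simp only [pow_succ, pow_zero, one_mul, Equiv.Perm.mul_apply, signedPerm_apply,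
    Equiv.Perm.one_apply]
  rw [← signedStep_comm h, signedStep_involutive j, signedStep_involutive i]

theorem signedPerm_mul_pow_three {i : ℕ} (h : 1 ≤ i) :
    (signedPerm i * signedPerm (i + 1)) ^ 3 = 1 := by
  ext x
  simp only [pow_succ, pow_zero, one_mul, Equiv.Perm.mul_apply, signedPerm_apply,
    Equiv.Perm.one_apply]
  rw [← signedStep_braid h x, signedStep_involutive i, signedStep_involutive (i + 1),
    signedStep_involutive i]

theorem signedPerm_mul_pow_four : (signedPerm 0 * signedPerm 1) ^ 4 = 1 := by
  ext x
  simp only [pow_succ, pow_zero, one_mul, Equiv.Perm.mul_apply, signedPerm_apply,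
    Equiv.Perm.one_apply]
  rw [signedStep_braid_zero x, signedStep_involutive 1, signedStep_involutive 0,
    signedStep_involutive 1, signedStep_involutive 0]

theorem signedPerm_isLiftable (n : ℕ) :
    (matB n).IsLiftable (fun i : Fin n => signedPerm i) := by
  have of_lt (i j : Fin n) (h : i < j) : (signedPerm i * signedPerm j) ^ matB n i j = 1 := by
    rw [matB_apply, if_neg h.ne]
    split_ifs with hzero hadj
    · rw [show i.val = 0 by omega, show j.val = 1 by omega]
      exact signedPerm_mul_pow_four
    · rw [show j.val = i.val + 1 by omega]
      exact signedPerm_mul_pow_three (by omega)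
    · exact signedPerm_mul_pow_two (by omega)
  intro i j
  rcases lt_trichotomy i j with h | rfl | h
  · exact of_lt i j h
  · rw [matB_apply, if_pos rfl, pow_one]
    exact Equiv.ext (signedStep_involutive i)
  · have hinv := congr_arg (·⁻¹) (of_lt j i h)
    rwa [← inv_pow, mul_inv_rev, signedPerm_inv, signedPerm_inv, inv_one,
      ← (matB n).symmetric] at hinv

/-- The action of `W_n` on `ℤ` by signed permutations, encoded as in `signedStep`. -/
noncomputable def signedAction (n : ℕ) : WB n →* Equiv.Perm ℤ :=
  (csB n).lift ⟨_, signedPerm_isLiftable n⟩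

theorem signedAction_simple (n : ℕ) (k : Fin n) (x : ℤ) :
    signedAction n ((csB n).simple k) x = signedStep k x :=
  DFunLike.congr_fun ((csB n).lift_apply_simple (signedPerm_isLiftable n) k) x

theorem signedAction_sB {n k : ℕ} (hk : k < n) (x : ℤ) :
    signedAction n (sB n k) x = signedStep k x := by
  rw [sB, dif_pos hk, signedAction_simple]

theorem signedAction_mul (n : ℕ) (w w' : WB n) (x : ℤ) :
    signedAction n (w * w') x = signedAction n w (signedAction n w' x) := by
  rw [map_mul, Equiv.Perm.mul_apply]

end SignedPermutations

section StandardSubgroups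

/-- The standard parabolic subgroup of type `B_l` of `W_n`. -/
def parB (n l : ℕ) : Subgroup (WB n) := parabolic (csB n) {k | k.val < l}

theorem symB_eq_parabolic (n l : ℕ) :
    symB n l = parabolic (csB n) {k | 1 ≤ k.val ∧ k.val < l} := by
  rw [symB, parabolic]
  congr 1
  ext w
  simp only [Set.mem_ofPred_eq, Set.mem_image, and_assoc, eq_comm (a := w)]

theorem symB_mono (n : ℕ) {l m : ℕ} (h : l ≤ m) : symB n l ≤ symB n m := by
  rw [symB_eq_parabolic, symB_eq_parabolic]
  exact parabolic_mono _ fun k hk => ⟨hk.1, hk.2.trans_le h⟩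

theorem symB_le_parB (n l : ℕ) : symB n l ≤ parB n l := by
  rw [symB_eq_parabolic]
  exact parabolic_mono _ fun k hk => hk.2

theorem sB_mem_parB {n l k : ℕ} (hkl : k < l) (hn : k < n) : sB n k ∈ parB n l := by
  rw [sB, dif_pos hn]
  exact simple_mem_parabolic _ hkl

theorem signedAction_of_mem_parB {n l : ℕ} {w : WB n} (hw : w ∈ parB n l) {x : ℤ}
    (hx : l < x ∨ x ≤ -l) : signedAction n w x = x := by
  induction hw using parabolic_induction with
  | one => simp only [map_one, Equiv.Perm.one_apply]
  | mul_simple w _ k hk ih =>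
    have hk : k.val < l := hk
    rw [signedAction_mul, signedAction_simple, signedStep_eq_self (by omega), ih]

theorem signedAction_nonpos_iff {n l : ℕ} {w : WB n} (hw : w ∈ symB n l) (x : ℤ) :
    signedAction n w x ≤ 0 ↔ x ≤ 0 := by
  rw [symB_eq_parabolic] at hw
  induction hw using parabolic_induction generalizing x with
  | one => simp only [map_one, Equiv.Perm.one_apply]
  | mul_simple w _ k hk ih =>
    rw [signedAction_mul, ih, signedAction_simple, signedStep_nonpos_iff hk.1]

end StandardSubgroups

section Lengths

theorem abs_signedAction_sub_le_length (n : ℕ) (w : WB n) (x : ℤ) :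
    |signedAction n w x - x| ≤ (csB n).length w := by
  obtain ⟨ω, hω, rfl⟩ := (csB n).exists_isReduced w
  rw [hω.eq]
  clear hω
  induction ω with
  | nil => simp
  | cons i ω ih =>
    rw [(csB n).wordProd_cons, signedAction_mul, signedAction_simple, List.length_cons]
    have hstep := abs_signedStep_sub_le i (signedAction n ((csB n).wordProd ω) x)
    have htriangle := abs_sub_le (signedStep i (signedAction n ((csB n).wordProd ω) x))
      (signedAction n ((csB n).wordProd ω) x) x
    push_cast
    linarith

theorem length_sB_le (n k : ℕ) : (csB n).length (sB n k) ≤ 1 := by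
  rw [sB]
  split_ifs <;> simp

theorem length_cosetB_le (n l j : ℕ) : (csB n).length (cosetB n l j) ≤ j := by
  induction j with
  | zero => simp [cosetB]
  | succ j ih => exact ((csB n).length_mul_le _ _).trans (add_le_add ih (length_sB_le n _))

theorem length_rB_le (n l : ℕ) : (csB n).length (rB n (l + 1)) ≤ l + 1 := by
  induction l with
  | zero => exact length_sB_le n 0
  | succ l ih =>
    have hmul := (csB n).length_mul_le (sB n (l + 1)) (rB n (l + 1))
    have hs := length_sB_le n (l + 1)
    rw [rB]
    omega

theorem length_tB_le (n l : ℕ) : (csB n).length (tB n (l + 1)) ≤ 2 * l + 1 := by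
  induction l with
  | zero => exact length_sB_le n 0
  | succ l ih =>
    have hmul := (csB n).length_mul_le (sB n (l + 1) * tB n (l + 1)) (sB n (l + 1))
    have hmul' := (csB n).length_mul_le (sB n (l + 1)) (tB n (l + 1))
    have hs := length_sB_le n (l + 1)
    rw [tB]
    omega

theorem length_mul_of_signedAction_eq {n l m : ℕ} {y d : WB n} {x : ℤ} (hy : y ∈ parB n l)
    (hd : (csB n).length d ≤ m) (hfix : l < signedAction n d x)
    (hmove : x + m ≤ signedAction n d x) :
    (csB n).length (y * d) = (csB n).length y + m := by
  -- `u` fixes the image of `x` under `d`, so `u * d` displaces `x` by at least `m`.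
  refine length_mul_of_forall_le (csB n) hy hd fun u hu => ?_
  have hlen := abs_signedAction_sub_le_length n (u * d) x
  rw [signedAction_mul, signedAction_of_mem_parB hu (Or.inl hfix), abs_le] at hlen
  omega

theorem signedAction_cosetB {n l j : ℕ} (hl : l < n) (hj : j ≤ l) :
    signedAction n (cosetB n l j) (l + 1 - j) = l + 1 := by
  induction j with
  | zero => simp [cosetB]
  | succ j ih =>
    have hstep : signedStep (l - j) (l + 1 - (j + 1 : ℕ)) = l + 1 - j := by grind [signedStep]
    rw [cosetB, signedAction_mul, signedAction_sB (by omega), hstep, ih (by omega)]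

theorem length_mul_cosetB {n l j : ℕ} (hl : l < n) (hj : j ≤ l) {u : WB n} (hu : u ∈ parB n l) :
    (csB n).length (u * cosetB n l j) = (csB n).length u + j := by
  have haction := signedAction_cosetB hl hj
  exact length_mul_of_signedAction_eq (x := l + 1 - j) hu (length_cosetB_le n l j)
    (by omega) (by omega)

theorem length_cosetB {n l j : ℕ} (hl : l < n) (hj : j ≤ l) :
    (csB n).length (cosetB n l j) = j := by
  simpa using length_mul_cosetB hl hj (one_mem _)

theorem cosetB_mem_symB {n l j : ℕ} (hl : l < n) (hj : j ≤ l) : cosetB n l j ∈ symB n (l + 1) := by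
  induction j with
  | zero => exact one_mem _
  | succ j ih => exact mul_mem (ih (by omega)) (sB_mem n _ _ (by omega) (by omega) (by omega))

theorem cosetB_succ (n l j : ℕ) :
    cosetB n (l + 1) (j + 1) = sB n (l + 1) * cosetB n l j := by
  induction j with
  | zero => simp [cosetB]
  | succ j ih => rw [cosetB, ih, cosetB, mul_assoc, Nat.add_sub_add_right]

theorem rB_mem_parB {n l m : ℕ} (hm : m < l) (hl : l ≤ n) : rB n (m + 1) ∈ parB n l := by
  induction m with
  | zero => exact sB_mem_parB (by omega) (by omega)
  | succ m ih => exact mul_mem (sB_mem_parB (by omega) (by omega)) (ih (by omega))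

theorem signedAction_rB_zero {n l : ℕ} (hl : l < n) :
    signedAction n (rB n (l + 1)) 0 = l + 1 := by
  induction l with
  | zero =>
    rw [rB, signedAction_sB hl]
    decide
  | succ l ih =>
    rw [rB, signedAction_mul, ih (by omega), signedAction_sB hl]
    grind [signedStep]

theorem signedAction_rB {n l : ℕ} (hl : l < n) {x : ℤ} (hx : -l ≤ x) (hx' : x < 0) :
    signedAction n (rB n (l + 1)) x = x + 1 := by
  induction l with
  | zero => omega
  | succ l ih =>
    rw [rB, signedAction_mul]
    rcases hx.eq_or_lt with rfl | h
    · have hfix : signedAction n (rB n (l + 1)) (-(l + 1 : ℕ)) = -(l + 1 : ℕ) :=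
        signedAction_of_mem_parB (rB_mem_parB l.lt_succ_self hl.le) (Or.inr le_rfl)
      rw [hfix, signedAction_sB hl]
      grind [signedStep]
    · rw [ih (by omega) (by omega), signedAction_sB hl]
      grind [signedStep]

theorem length_mul_rB {n l : ℕ} (hl : l < n) {y : WB n} (hy : y ∈ parB n l) :
    (csB n).length (y * rB n (l + 1)) = (csB n).length y + (l + 1) := by
  have haction := signedAction_rB_zero hl
  exact length_mul_of_signedAction_eq (x := 0) hy (length_rB_le n l) (by omega) (by omega)

theorem length_rB {n l : ℕ} (hl : l < n) : (csB n).length (rB n (l + 1)) = l + 1 := by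
  simpa using length_mul_rB hl (one_mem _)

theorem mul_rB_notMem_symB {n l : ℕ} (hl : l < n) {y : WB n} (hy : y ∈ parB n l) :
    y * rB n (l + 1) ∉ symB n n := by
  intro h
  have hsign := signedAction_nonpos_iff h 0
  rw [signedAction_mul, signedAction_rB_zero hl, signedAction_of_mem_parB hy (by omega)] at hsign
  omega

theorem signedAction_tB {n l : ℕ} (hl : l < n) :
    signedAction n (tB n (l + 1)) (-l) = l + 1 := by
  induction l with
  | zero =>
    rw [tB, signedAction_sB hl]
    decide
  | succ l ih =>
    have hstep : signedStep (l + 1) (-(l + 1 : ℕ)) = -l := by grind [signedStep]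
    rw [tB, signedAction_mul, signedAction_mul, signedAction_sB hl (-(l + 1 : ℕ)), hstep,
      ih (by omega), signedAction_sB hl]
    grind [signedStep]

theorem length_mul_tB {n l : ℕ} (hl : l < n) {y : WB n} (hy : y ∈ parB n l) :
    (csB n).length (y * tB n (l + 1)) = (csB n).length y + (2 * l + 1) := by
  have haction := signedAction_tB hl
  exact length_mul_of_signedAction_eq (x := -l) hy (length_tB_le n l) (by omega) (by omega)

theorem length_tB {n l : ℕ} (hl : l < n) : (csB n).length (tB n (l + 1)) = 2 * l + 1 := by
  simpa using length_mul_tB hl (one_mem _)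

end Lengths

section LengthOfAB

/-- The sum of the positive values that `w` takes on the `n` negative letters. It is bounded by
the length of `w`, and used to compute the length of `a_l u` for `u` in `𝔖_n`. -/
noncomputable def positiveSum (n : ℕ) (w : WB n) : ℤ :=
  ∑ x ∈ Finset.Icc (1 - n : ℤ) 0, max (signedAction n w x) 0

theorem positiveSum_simple_mul_le (n : ℕ) (w : WB n) (k : Fin n) :
    positiveSum n ((csB n).simple k * w) ≤ positiveSum n w + 1 := by
  have hcard : (∑ x ∈ Finset.Icc (1 - n : ℤ) 0,
      if signedAction n w x = (k : ℕ) then (1 : ℤ) else 0) ≤ 1 := by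
    rw [Finset.sum_boole, Nat.cast_le_one, Finset.card_le_one]
    intro x hx y hy
    exact (signedAction n w).injective
      ((Finset.mem_filter.mp hx).2.trans (Finset.mem_filter.mp hy).2.symm)
  calc positiveSum n ((csB n).simple k * w)
      ≤ ∑ x ∈ Finset.Icc (1 - n : ℤ) 0, (max (signedAction n w x) 0 +
          if signedAction n w x = (k : ℕ) then 1 else 0) := by
        refine Finset.sum_le_sum fun x _ => ?_
        rw [signedAction_mul, signedAction_simple]
        exact max_signedStep_le _ _
    _ ≤ positiveSum n w + 1 := by
        rw [Finset.sum_add_distrib]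
        exact add_le_add_right hcard _

theorem positiveSum_le_length (n : ℕ) (w : WB n) : positiveSum n w ≤ (csB n).length w := by
  obtain ⟨ω, hω, rfl⟩ := (csB n).exists_isReduced w
  rw [hω.eq]
  clear hω
  induction ω with
  | nil =>
    refine (Finset.sum_eq_zero fun x hx => ?_).le
    rw [(csB n).wordProd_nil, map_one, Equiv.Perm.one_apply,
      max_eq_right (Finset.mem_Icc.mp hx).2]
  | cons i ω ih =>
    have hstep := positiveSum_simple_mul_le n ((csB n).wordProd ω) i
    rw [(csB n).wordProd_cons, List.length_cons]
    push_cast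
    linarith

theorem signedAction_mem_Icc_iff {n : ℕ} {u : WB n} (hu : u ∈ symB n n) (x : ℤ) :
    signedAction n u x ∈ Finset.Icc (1 - n : ℤ) 0 ↔ x ∈ Finset.Icc (1 - n : ℤ) 0 := by
  have hlow (z : ℤ) (hz : z ≤ -n) : signedAction n u z = z :=
    signedAction_of_mem_parB (symB_le_parB n n hu) (Or.inr hz)
  have hlow_iff : signedAction n u x ≤ -n ↔ x ≤ -n := by
    refine ⟨fun h => ?_, fun h => (hlow x h).trans_le h⟩
    rwa [← (signedAction n u).injective (hlow _ h)]
  rw [Finset.mem_Icc, Finset.mem_Icc, signedAction_nonpos_iff hu]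
  omega

theorem positiveSum_mul_of_mem_symB {n : ℕ} (w : WB n) {u : WB n} (hu : u ∈ symB n n) :
    positiveSum n (w * u) = positiveSum n w :=
  Finset.sum_equiv (signedAction n u) (fun x => (signedAction_mem_Icc_iff hu x).symm)
    fun x _ => by rw [signedAction_mul]

theorem aB_succ (n l : ℕ) : aB n (l + 1) = aB n l * rB n (l + 1) := by
  simp [aB, List.range_succ]

theorem aB_mem_parB {n l : ℕ} (hl : l ≤ n) : aB n l ∈ parB n l := by
  refine list_prod_mem fun x hx => ?_
  obtain ⟨i, hi, rfl⟩ := List.mem_map.mp hx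
  exact rB_mem_parB (List.mem_range.mp hi) hl

theorem signedAction_aB {n l : ℕ} (hl : l ≤ n) {x : ℤ} (hx : -l < x) (hx' : x ≤ 0) :
    signedAction n (aB n l) x = l + x := by
  induction l generalizing x with
  | zero => omega
  | succ l ih =>
    rw [aB_succ, signedAction_mul]
    rcases hx'.eq_or_lt with rfl | h
    · rw [signedAction_rB_zero hl, signedAction_of_mem_parB (aB_mem_parB (by omega)) (by omega)]
      push_cast
      ring
    · rw [signedAction_rB hl (by omega) h, ih (by omega) (by omega) (by omega)]
      push_cast
      ring

theorem length_aB_le (n l : ℕ) : (csB n).length (aB n l) ≤ ∑ i ∈ Finset.range l, (i + 1) := by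
  induction l with
  | zero => simp [aB]
  | succ l ih =>
    rw [aB_succ, Finset.sum_range_succ]
    exact ((csB n).length_mul_le _ _).trans (add_le_add ih (length_rB_le n l))

theorem sum_le_positiveSum_aB {n l : ℕ} (hl : l ≤ n) :
    ((∑ i ∈ Finset.range l, (i + 1) : ℕ) : ℤ) ≤ positiveSum n (aB n l) := by
  let x (i : ℕ) : ℤ := i + 1 - l
  have hx_inj : Function.Injective x := fun i j h => by
    simp only [x] at h
    omega
  have hx_subset : (Finset.range l).image x ⊆ Finset.Icc (1 - n : ℤ) 0 := by
    intro z hz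
    obtain ⟨i, hi, rfl⟩ := Finset.mem_image.mp hz
    rw [Finset.mem_range] at hi
    simp only [x, Finset.mem_Icc]
    omega
  calc ((∑ i ∈ Finset.range l, (i + 1) : ℕ) : ℤ)
      = ∑ i ∈ Finset.range l, max (signedAction n (aB n l) (x i)) 0 := by
        rw [Nat.cast_sum]
        refine Finset.sum_congr rfl fun i hi => ?_
        rw [Finset.mem_range] at hi
        rw [signedAction_aB hl (by simp only [x]; omega) (by simp only [x]; omega)]
        simp only [x]
        omega
    _ = ∑ z ∈ (Finset.range l).image x, max (signedAction n (aB n l) z) 0 :=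
        by rw [Finset.sum_image hx_inj.injOn]
    _ ≤ positiveSum n (aB n l) :=
        Finset.sum_le_sum_of_subset_of_nonneg hx_subset fun _ _ _ => le_max_right _ _

theorem length_aB_mul {n l : ℕ} (hl : l ≤ n) {u : WB n} (hu : u ∈ symB n n) :
    (csB n).length (aB n l * u) = (csB n).length (aB n l) + (csB n).length u := by
  have hlower (v : WB n) (hv : v ∈ symB n n) :
      ∑ i ∈ Finset.range l, (i + 1) ≤ (csB n).length (aB n l * v) := by
    have hsum := (sum_le_positiveSum_aB hl).trans_eq (positiveSum_mul_of_mem_symB (aB n l) hv).symm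
    exact_mod_cast hsum.trans (positiveSum_le_length n _)
  have hlen : (csB n).length (aB n l) = ∑ i ∈ Finset.range l, (i + 1) :=
    (length_aB_le n l).antisymm (by simpa using hlower 1 (one_mem _))
  rw [hlen]
  rw [symB_eq_parabolic] at hu hlower
  exact length_mul_of_forall_le_right (csB n) hu (length_aB_le n l) hlower

end LengthOfAB

section LongestElements

theorem sigmaB_spec (n l : ℕ) : IsLongestIn (csB n) (symB n l) (sigmaB n l) :=
  (exists_longest_symB n l).choose_spec

theorem isLongestIn_symB_succ {n l : ℕ} (hl : l < n) {w : WB n}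
    (hw : IsLongestIn (csB n) (symB n (l + 1)) w) :
    ∃ u, IsLongestIn (csB n) (symB n l) u ∧ w = u * cosetB n l l := by
  obtain ⟨u, hu, j, hj, rfl⟩ := symB_coset n l hl w hw.1
  have hmax : ∀ y ∈ symB n l, (csB n).length y + l ≤ (csB n).length u + j := by
    intro y hy
    rw [← length_mul_cosetB hl hj (symB_le_parB n l hu),
      ← length_mul_cosetB hl le_rfl (symB_le_parB n l hy)]
    exact hw.2 _ (mul_mem (symB_mono n l.le_succ hy) (cosetB_mem_symB hl le_rfl))
  obtain rfl : j = l := by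
    have := hmax u hu
    omega
  exact ⟨u, ⟨hu, fun y hy => Nat.le_of_add_le_add_right (hmax y hy)⟩, rfl⟩

theorem eq_sigmaB {n l : ℕ} (hl : l ≤ n) {w : WB n} (hw : IsLongestIn (csB n) (symB n l) w) :
    w = sigmaB n l := by
  induction l generalizing w with
  | zero =>
    have hbot : symB n 0 = ⊥ := by simp [symB]
    have hw_mem := hw.1
    have hσ_mem := (sigmaB_spec n 0).1
    rw [hbot, Subgroup.mem_bot] at hw_mem hσ_mem
    rw [hw_mem, hσ_mem]
  | succ l ih =>
    obtain ⟨u, hu, rfl⟩ := isLongestIn_symB_succ hl hw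
    obtain ⟨v, hv, e⟩ := isLongestIn_symB_succ hl (sigmaB_spec n (l + 1))
    rw [e, ih (by omega) hu, ih (by omega) hv]

theorem sigmaB_inv {n l : ℕ} (hl : l ≤ n) : (sigmaB n l)⁻¹ = sigmaB n l :=
  eq_sigmaB hl ⟨inv_mem (sigmaB_spec n l).1, fun u hu =>
    ((sigmaB_spec n l).2 u hu).trans_eq ((csB n).length_inv _).symm⟩

theorem sigmaB_succ {n l : ℕ} (hl : l < n) :
    sigmaB n (l + 1) = sigmaB n l * cosetB n l l := by
  obtain ⟨u, hu, e⟩ := isLongestIn_symB_succ hl (sigmaB_spec n (l + 1))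
  rw [e, eq_sigmaB hl.le hu]

end LongestElements

section JucysMurphy

/-- The braid relations of type `B_n` for the elements `g_0, …, g_{n-1}` of a group. -/
structure BraidRelations {G : Type*} [Group G] (n : ℕ) (g : ℕ → G) : Prop where
  comm : ∀ i k, i + 2 ≤ k → k < n → Commute (g i) (g k)
  braid : ∀ i, 1 ≤ i → i + 1 < n → g (i + 1) * g i * g (i + 1) = g i * g (i + 1) * g i
  braid_zero : 1 < n → g 0 * g 1 * g 0 * g 1 = g 1 * g 0 * g 1 * g 0

theorem commute_conj_of_braid {M : Type*} [Monoid M] {a b x : M} (h : b * a * b = a * b * a)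
    (hx : Commute b x) : Commute a (b * (a * x * a) * b) :=
  calc a * (b * (a * x * a) * b) = (a * b * a) * x * (a * b) := by simp only [mul_assoc]
    _ = b * a * (b * x) * (a * b) := by rw [← h]; simp only [mul_assoc]
    _ = b * a * x * (b * a * b) := by rw [hx.eq]; simp only [mul_assoc]
    _ = b * (a * x * a) * b * a := by rw [h]; simp only [mul_assoc]

variable {G : Type*} [Group G] (g : ℕ → G)

/-- The Jucys–Murphy elements `g_{i-1} ⋯ g_1 g_0 g_1 ⋯ g_{i-1}`, indexed like the `t_i`. -/
def jucysMurphy : ℕ → G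
  | 0 => 1
  | 1 => g 0
  | i + 2 => g (i + 1) * jucysMurphy (i + 1) * g (i + 1)

/-- The product `g_l ⋯ g_1`. -/
def descProd : ℕ → G
  | 0 => 1
  | l + 1 => g (l + 1) * descProd l

variable {g} {n : ℕ}

theorem commute_descProd {x : G} {m : ℕ} (h : ∀ j, 1 ≤ j → j ≤ m → Commute x (g j)) :
    Commute x (descProd g m) := by
  induction m with
  | zero => exact Commute.one_right _
  | succ m ih =>
    exact (h _ (by omega) le_rfl).mul_right (ih fun j hj hjm => h j hj (by omega))

theorem BraidRelations.commute_jucysMurphy_of_lt (hg : BraidRelations n g) {i j : ℕ} (hij : i < j)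
    (hj : j < n) : Commute (g j) (jucysMurphy g i) := by
  induction i with
  | zero => exact Commute.one_right _
  | succ i ih =>
    have h := (hg.comm i j (by omega) hj).symm
    cases i with
    | zero => exact h
    | succ i => exact (h.mul_right (ih (by omega))).mul_right h

theorem BraidRelations.commute_jucysMurphy (hg : BraidRelations n g) {i j : ℕ} (hij : j < i)
    (hi : i < n) : Commute (g j) (jucysMurphy g (i + 1)) := by
  induction i with
  | zero => omega
  | succ i ih =>
    rcases Nat.lt_succ_iff_lt_or_eq.mp hij with h | rfl
    · have hcomm := hg.comm j (i + 1) (by omega) hi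
      exact (hcomm.mul_right (ih h (by omega))).mul_right hcomm
    · cases j with
      | zero =>
        have h := hg.braid_zero hi
        simp only [Commute, SemiconjBy, jucysMurphy, zero_add, ← mul_assoc] at h ⊢
        exact h
      | succ j =>
        exact commute_conj_of_braid (hg.braid (j + 1) (by omega) hi)
          (hg.commute_jucysMurphy_of_lt (by omega) hi)

theorem BraidRelations.commute_jucysMurphy_jucysMurphy (hg : BraidRelations n g) {i j : ℕ}
    (hij : i ≤ j) (hj : j < n) : Commute (jucysMurphy g i) (jucysMurphy g (j + 1)) := by
  induction i with
  | zero => exact Commute.one_left _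
  | succ i ih =>
    have h := hg.commute_jucysMurphy (j := i) hij hj
    cases i with
    | zero => exact h
    | succ i => exact (h.mul_left (ih (by omega))).mul_left h

theorem jucysMurphy_mul_descProd_inv (g : ℕ → G) (l : ℕ) :
    jucysMurphy g (l + 1) * descProd g⁻¹ l = descProd g l * g 0 := by
  induction l with
  | zero => simp [jucysMurphy, descProd]
  | succ l ih =>
    rw [jucysMurphy, descProd, descProd, mul_assoc (g (l + 1)) (descProd g l), ← ih]
    simp [mul_assoc]

end JucysMurphy

section ShiftedProduct

variable {A R : Type*} [CommRing A] [Ring R] [Algebra A R] {g : ℕ → Rˣ} {n : ℕ}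

/-- The product `(J_1 + z) ⋯ (J_l + z)` of the shifted Jucys–Murphy elements; `P_l` is the case
`z = V⁻¹`. -/
def shiftedProd (g : ℕ → Rˣ) (z : A) (l : ℕ) : R :=
  ((List.range l).map fun i => (jucysMurphy g (i + 1)).val + algebraMap A R z).prod

theorem shiftedProd_zero (g : ℕ → Rˣ) (z : A) : shiftedProd g z 0 = 1 := rfl

theorem shiftedProd_succ (g : ℕ → Rˣ) (z : A) (l : ℕ) :
    shiftedProd g z (l + 1) =
      shiftedProd g z l * ((jucysMurphy g (l + 1)).val + algebraMap A R z) := by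
  simp [shiftedProd, List.range_succ]

theorem BraidRelations.commute_shiftedProd_of_lt (hg : BraidRelations n g) (z : A) {l j : ℕ}
    (hl : l < j) (hj : j < n) : Commute (g j : R) (shiftedProd g z l) := by
  induction l with
  | zero => exact Commute.one_right _
  | succ l ih =>
    rw [shiftedProd_succ]
    exact (ih (by omega)).mul_right (((hg.commute_jucysMurphy_of_lt hl hj).units_val).add_right
      (Algebra.commutes z _).symm)

theorem commute_mul_add_of_quadratic {t x : R} {z ξ : A} (ht : t * t = 1 + algebraMap A R ξ * t)
    (hx : Commute x (t * x * t)) :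
    Commute t ((x + algebraMap A R z) * (t * x * t + algebraMap A R z)) := by
  have hprod : Commute t (x * (t * x * t)) := by
    have hassoc : t * (x * (t * x * t)) = t * x * t * x * t := by simp only [mul_assoc]
    rw [Commute, SemiconjBy, hassoc, hx.eq]
  have hsum : Commute t (x + t * x * t) := by
    have hleft : t * (t * x * t) = x * t + algebraMap A R ξ * (t * x * t) := by
      rw [← mul_assoc, ← mul_assoc, ht]
      noncomm_ring
    have hright : t * x * t * t = t * x + algebraMap A R ξ * (t * x * t) := by
      rw [mul_assoc (t * x), ht, mul_add, mul_one, ← mul_assoc (t * x), ← Algebra.commutes ξ]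
      simp only [mul_assoc]
    rw [Commute, SemiconjBy, mul_add, add_mul, hleft, hright]
    abel
  have hexpand : (x + algebraMap A R z) * (t * x * t + algebraMap A R z) =
      x * (t * x * t) + algebraMap A R z * (x + t * x * t) +
        algebraMap A R z * algebraMap A R z := by
    rw [add_mul, mul_add, mul_add, ← Algebra.commutes z x, mul_add]
    abel
  have hz : Commute t (algebraMap A R z) := (Algebra.commutes z t).symm
  rw [hexpand]
  exact (hprod.add_right (hz.mul_right hsum)).add_right (hz.mul_right hz)

variable {ξ : ℕ → A}

theorem BraidRelations.commute_shiftedProd (hg : BraidRelations n g)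
    (hq : ∀ i < n, (g i : R) * g i = 1 + algebraMap A R (ξ i) * g i) (z : A) {l j : ℕ}
    (hj : 1 ≤ j) (hjl : j < l) (hl : l ≤ n) : Commute (g j : R) (shiftedProd g z l) := by
  induction l with
  | zero => omega
  | succ l ih =>
    rw [shiftedProd_succ]
    rcases Nat.lt_succ_iff_lt_or_eq.mp hjl with h | rfl
    · exact (ih h (by omega)).mul_right (((hg.commute_jucysMurphy h hl).units_val).add_right
        (Algebra.commutes z _).symm)
    · obtain ⟨j, rfl⟩ : ∃ i, j = i + 1 := ⟨j - 1, by omega⟩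
      have hcomm := (hg.commute_jucysMurphy_jucysMurphy (j + 1).le_refl hl).units_val
      rw [shiftedProd_succ, mul_assoc]
      refine (hg.commute_shiftedProd_of_lt z (by omega) hl).mul_right ?_
      rw [jucysMurphy, Units.val_mul, Units.val_mul] at hcomm ⊢
      exact commute_mul_add_of_quadratic (hq _ hl) hcomm

theorem mul_add_mul_sub_of_quadratic {t : R} {z V : A} (hzV : z * V = 1)
    (ht : t * t = 1 + algebraMap A R (V - z) * t) :
    (t + algebraMap A R z) * (t - algebraMap A R V) = 0 := by
  have hzV' : algebraMap A R z * algebraMap A R V = 1 := by rw [← map_mul, hzV, map_one]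
  rw [add_mul, mul_sub, mul_sub, ht, hzV', map_sub, ← Algebra.commutes V t, sub_mul]
  abel

theorem BraidRelations.shiftedProd_mul_sub (hg : BraidRelations n g)
    {z V : A} (hzV : z * V = 1) (hq : (g 0 : R) * g 0 = 1 + algebraMap A R (V - z) * g 0) {l : ℕ}
    (hpos : 0 < l) (hl : l ≤ n) : shiftedProd g z l * ((g 0 : R) - algebraMap A R V) = 0 := by
  induction l, hpos using Nat.le_induction with
  | base =>
    rw [shiftedProd_succ, shiftedProd_zero, one_mul]
    exact mul_add_mul_sub_of_quadratic hzV hq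
  | succ l hpos ih =>
    have hcomm : Commute ((jucysMurphy g (l + 1)).val + algebraMap A R z)
        ((g 0 : R) - algebraMap A R V) :=
      (((hg.commute_jucysMurphy hpos hl).symm.units_val).sub_right
        (Algebra.commutes V _).symm).add_left (Algebra.commutes z _)
    rw [shiftedProd_succ, mul_assoc, hcomm.eq, ← mul_assoc, ih (by omega), zero_mul]

theorem val_eq_inv_add_of_quadratic {u : Rˣ} {c : R} (h : (u : R) * u = 1 + c * u) :
    (u : R) = u⁻¹.val + c := by
  have hmul := congrArg (fun x => x * u⁻¹.val) h
  simpa [mul_assoc, add_mul] using hmul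

theorem BraidRelations.shiftedProd_mul_descProd_mul_sub (hg : BraidRelations n g)
    (hq : ∀ i < n, (g i : R) * g i = 1 + algebraMap A R (ξ i) * g i) {z V : A} (hzV : z * V = 1)
    (hξ : ξ 0 = V - z) {l m : ℕ} (hm : m < l) (hl : l ≤ n) {u : Rˣ}
    (hu : ∀ j ≤ m, Commute u (g j)) :
    shiftedProd g z l * u * (descProd g m).val * ((g 0 : R) - algebraMap A R V) = 0 := by
  have hu_desc : Commute (u : R) (descProd g m).val :=
    (commute_descProd fun j _ hj => hu j hj).units_val
  have hdesc_prod : Commute (descProd g m).val (shiftedProd g z l) := by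
    clear hu hu_desc
    induction m with
    | zero => exact Commute.one_left _
    | succ m ih =>
      rw [descProd, Units.val_mul]
      exact (hg.commute_shiftedProd hq z m.succ_pos hm hl).mul_left (ih (by omega))
  have hu_sub : Commute (u : R) ((g 0 : R) - algebraMap A R V) :=
    ((hu 0 m.zero_le).units_val).sub_right (Algebra.commutes V _).symm
  calc shiftedProd g z l * u * (descProd g m).val * ((g 0 : R) - algebraMap A R V)
      = (descProd g m).val * shiftedProd g z l * (u * ((g 0 : R) - algebraMap A R V)) := by
        rw [mul_assoc _ (u : R), hu_desc.eq, ← mul_assoc, ← hdesc_prod.eq, mul_assoc _ (u : R)]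
    _ = (descProd g m).val * (shiftedProd g z l * ((g 0 : R) - algebraMap A R V)) * u := by
        rw [hu_sub.eq]
        simp only [mul_assoc]
    _ = 0 := by
        rw [hg.shiftedProd_mul_sub hzV (hξ ▸ hq 0 (by omega)) (by omega) hl, mul_zero, zero_mul]

theorem BraidRelations.shiftedProd_mul_descProd_sub (hg : BraidRelations n g)
    (hq : ∀ i < n, (g i : R) * g i = 1 + algebraMap A R (ξ i) * g i) {z V : A} (hzV : z * V = 1)
    (hξ : ξ 0 = V - z) {l m : ℕ} (hm : m ≤ l) (hl : l < n) {u : Rˣ}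
    (hu : ∀ j < m, Commute u (g j)) :
    shiftedProd g z l * u * ((descProd g m).val - (descProd g⁻¹ m).val) *
      ((g 0 : R) - algebraMap A R V) = 0 := by
  induction m generalizing u with
  | zero => simp [descProd]
  | succ m ih =>
    have hsplit : (descProd g (m + 1)).val - (descProd g⁻¹ (m + 1)).val =
        (g (m + 1))⁻¹.val * ((descProd g m).val - (descProd g⁻¹ m).val) +
          algebraMap A R (ξ (m + 1)) * (descProd g m).val := by
      rw [descProd, descProd, Pi.inv_apply, Units.val_mul, Units.val_mul,
        val_eq_inv_add_of_quadratic (hq (m + 1) (by omega)), add_mul, mul_sub]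
      abel
    have hdiff := ih (u := u * (g (m + 1))⁻¹) (by omega) fun j hj =>
      (hu j (by omega)).mul_left (hg.comm j (m + 1) (by omega) (by omega)).symm.inv_left
    have hdesc := hg.shiftedProd_mul_descProd_mul_sub hq hzV hξ (m := m) hm hl.le
      fun j hj => hu j (by omega)
    rw [Units.val_mul, ← mul_assoc] at hdiff
    rw [hsplit, mul_add, add_mul, ← mul_assoc _ (g (m + 1))⁻¹.val, hdiff, zero_add,
      ← Algebra.smul_def, mul_smul_comm, smul_mul_assoc, hdesc, smul_zero]

theorem BraidRelations.shiftedProd_mul_eq (hg : BraidRelations n g)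
    (hq : ∀ i < n, (g i : R) * g i = 1 + algebraMap A R (ξ i) * g i) {z V : A} (hzV : z * V = 1)
    (hξ : ξ 0 = V - z) {l : ℕ} (hl : l < n) :
    shiftedProd g z l *
        ((descProd g⁻¹ l).val * (g 0)⁻¹.val + algebraMap A R V * (descProd g l).val) =
      shiftedProd g z l *
        ((descProd g l).val * g 0 + algebraMap A R z * (descProd g⁻¹ l).val) := by
  have h := hg.shiftedProd_mul_descProd_sub hq hzV hξ le_rfl hl (u := 1)
    fun j _ => Commute.one_left _
  have hinv := val_eq_inv_add_of_quadratic (hq 0 (by omega))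
  rw [hξ, map_sub, ← sub_eq_iff_eq_add] at hinv
  rw [Units.val_one, mul_one, mul_assoc] at h
  rw [← sub_eq_zero, ← mul_sub, ← neg_eq_zero, ← mul_neg, ← h, ← hinv, Algebra.commutes V,
    Algebra.commutes z]
  congr 1
  noncomm_ring

end ShiftedProduct

section CoefficientSubgroups

variable {Γ : Type*}

open Classical in
theorem coeffAt_vpow (γ δ : Γ) : (vpow γ).coeffAt δ = if γ = δ then 1 else 0 :=
  Finsupp.single_apply

variable [AddCommGroup Γ]

theorem vpow_mul (γ δ : Γ) : vpow γ * vpow δ = vpow (γ + δ) :=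
  (AddMonoidAlgebra.single_mul_single γ δ (1 : ℤ) 1).trans (by rw [mul_one]; rfl)

theorem exists_of_coeffAt_mul_ne_zero {a b : GroupRing Γ} {γ : Γ} (h : (a * b).coeffAt γ ≠ 0) :
    ∃ α β, a.coeffAt α ≠ 0 ∧ b.coeffAt β ≠ 0 ∧ α + β = γ := by
  classical
  by_contra! hadd
  refine h ((AddMonoidAlgebra.coeff_mul (R := ℤ) a b γ).trans ?_)
  refine Finset.sum_eq_zero fun α hα => Finset.sum_eq_zero fun β hβ => ?_
  exact if_neg (hadd α β (Finsupp.mem_support_iff.mp hα) (Finsupp.mem_support_iff.mp hβ))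

/-- The subgroup of `A` spanned by the `v ^ γ` with `γ ∈ X`. -/
def supportedIn (X : Set Γ) : AddSubgroup (GroupRing Γ) where
  carrier := {a | ∀ γ, a.coeffAt γ ≠ 0 → γ ∈ X}
  zero_mem' γ h := absurd (coeffAt_zero γ) h
  add_mem' {a b} ha hb γ h := by
    by_contra hγ
    rw [coeffAt_add, not_ne_iff.mp (mt (ha γ) hγ), not_ne_iff.mp (mt (hb γ) hγ), add_zero] at h
    exact h rfl
  neg_mem' {a} ha γ h := ha γ (by rwa [coeffAt_neg, neg_ne_zero] at h)

theorem supportedIn_mono {X Y : Set Γ} (h : X ⊆ Y) : supportedIn X ≤ supportedIn Y :=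
  fun _ ha γ hγ => h (ha γ hγ)

theorem mul_mem_supportedIn {X Y Z : Set Γ} (h : ∀ α ∈ X, ∀ β ∈ Y, α + β ∈ Z)
    {a b : GroupRing Γ} (ha : a ∈ supportedIn X) (hb : b ∈ supportedIn Y) :
    a * b ∈ supportedIn Z := by
  intro γ hγ
  obtain ⟨α, β, hα, hβ, rfl⟩ := exists_of_coeffAt_mul_ne_zero hγ
  exact h α (ha α hα) β (hb β hβ)

theorem vpow_mem_supportedIn {X : Set Γ} {γ : Γ} (h : γ ∈ X) : vpow γ ∈ supportedIn X := by
  classical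
  intro δ hδ
  rw [coeffAt_vpow, ite_ne_right_iff] at hδ
  exact hδ.1 ▸ h

end CoefficientSubgroups

section HeckeAlgebra

variable {B W : Type*} [Group W] {M : CoxeterMatrix B} {cs : CoxeterSystem M W}
variable {Γ : Type*} [AddCommGroup Γ] [LinearOrder Γ] (L : WeightFunction cs Γ)

theorem prod_map_T {ws : List W} (h : (ws.map cs.length).sum ≤ cs.length ws.prod) :
    (ws.map (T L)).prod = T L ws.prod := by
  induction ws with
  | nil => exact (T_one L).symm
  | cons w ws ih =>
    simp only [List.map_cons, List.sum_cons, List.prod_cons] at h ⊢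
    have hsub : cs.length ws.prod ≤ (ws.map cs.length).sum :=
      List.apply_prod_le_sum_map ws cs.length cs.length_one.le cs.length_mul_le
    have hmul := cs.length_mul_le w ws.prod
    rw [ih (by omega), T_mul L _ _ (by omega)]

theorem TUnit_simple_inv (i : B) : (TUnit L (cs.simple i))⁻¹.val = Tsinv L i :=
  Units.inv_eq_of_mul_eq_one_right (T_simple_inv L i).1

theorem mul_Tsinv (h : Hecke L) (i : B) :
    h * Tsinv L i = h * T L (cs.simple i) - xi L i • h := by
  rw [Tsinv, mul_sub, Algebra.smul_def, Algebra.commutes]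

theorem T_mul_simple (w : W) (i : B) :
    T L (w * cs.simple i) = T L w * T L (cs.simple i) ∨
      T L (w * cs.simple i) = T L w * Tsinv L i := by
  rcases cs.length_mul_simple w i with h | h
  · exact Or.inl (T_mul L _ _ (by rw [h, cs.length_simple])).symm
  · have hmul := T_mul L (w * cs.simple i) (cs.simple i) (by simp [← h])
    rw [cs.simple_mul_simple_cancel_right] at hmul
    exact Or.inr (by rw [← hmul, mul_assoc, Tsinv, (T_simple_inv L i).1, mul_one])

theorem T_mul_T_simple (w : W) (i : B) :
    T L w * T L (cs.simple i) = T L (w * cs.simple i) ∨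
      T L w * T L (cs.simple i) = T L (w * cs.simple i) + xi L i • T L w := by
  refine (T_mul_simple L w i).imp Eq.symm fun h => ?_
  rw [h, mul_Tsinv, sub_add_cancel]

@[elab_as_elim]
theorem T_induction {J : Set B} {p : Hecke L → Prop} (one : p 1)
    (mul_T : ∀ h, ∀ i ∈ J, p h → p (h * T L (cs.simple i)))
    (mul_Tsinv : ∀ h, ∀ i ∈ J, p h → p (h * Tsinv L i)) {u : W} (hu : u ∈ parabolic cs J) :
    p (T L u) := by
  induction hu using parabolic_induction with
  | one => rwa [T_one]
  | mul_simple w _ i hi ih =>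
    rcases T_mul_simple L w i with h | h
    · exact h ▸ mul_T _ i hi ih
    · exact h ▸ mul_Tsinv _ i hi ih

theorem bar_mul (h h' : Hecke L) : bar L (h * h') = bar L h * bar L h' := by
  induction h using hecke_induction L with
  | hadd h g e e' => rw [add_mul, bar_add, e, e', bar_add, add_mul]
  | hT a w =>
    rw [smul_mul_assoc, bar_smul, bar_smul, smul_mul_assoc]
    congr 1
    induction w using length_induction cs with
    | h1 => rw [bar_T_one, T_one, one_mul, one_mul]
    | hs i u hu ih =>
      rw [bar_T_mul L hu, ← T_simple_mul_up L hu, mul_assoc, bar_T_simple_mul, ih, mul_assoc]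

theorem bar_one : bar L 1 = 1 := by rw [← T_one, bar_T_one, T_one]

theorem bar_algebraMap (a : GroupRing Γ) :
    bar L (algebraMap (GroupRing Γ) (Hecke L) a) = algebraMap (GroupRing Γ) (Hecke L) (barA a) := by
  rw [Algebra.algebraMap_eq_smul_one, Algebra.algebraMap_eq_smul_one, bar_smul, bar_one]

theorem bar_T_simple (i : B) : bar L (T L (cs.simple i)) = Tsinv L i := by
  rw [bar_T, cs.inv_simple, TUnit_simple_inv]

theorem bar_Tsinv (i : B) : bar L (Tsinv L i) = T L (cs.simple i) := by
  rw [← bar_T_simple, bar_bar]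

variable {L}

theorem mul_mem_of_forall_T_mul {σ : Type*} [SetLike σ (Hecke L)] [AddSubmonoidClass σ (Hecke L)]
    {N : σ} {h x : Hecke L}
    (hN : ∀ w, (T L).repr h w ≠ 0 → (T L).repr h w • (T L w * x) ∈ N) : h * x ∈ N := by
  rw [← (T L).linearCombination_repr h, Finsupp.linearCombination_apply, Finsupp.sum,
    Finset.sum_mul]
  refine sum_mem fun w hw => ?_
  rw [smul_mul_assoc]
  exact hN w (Finsupp.mem_support_iff.mp hw)

theorem mul_mem_of_forall_mul_T {σ : Type*} [SetLike σ (Hecke L)] [AddSubmonoidClass σ (Hecke L)]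
    {N : σ} {h x : Hecke L}
    (hN : ∀ w, (T L).repr x w ≠ 0 → (T L).repr x w • (h * T L w) ∈ N) : h * x ∈ N := by
  rw [← (T L).linearCombination_repr x, Finsupp.linearCombination_apply, Finsupp.sum,
    Finset.mul_sum]
  refine sum_mem fun w hw => ?_
  rw [mul_smul_comm]
  exact hN w (Finsupp.mem_support_iff.mp hw)

variable (L) in
/-- The `A`-span of the `T_w` with `w ∈ X`. -/
noncomputable def spanT (X : Set W) : Submodule (GroupRing Γ) (Hecke L) :=
  Submodule.span (GroupRing Γ) (T L '' X)

theorem mem_of_repr_ne_zero {X : Set W} {h : Hecke L} (hh : h ∈ spanT L X) {y : W}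
    (hy : (T L).repr h y ≠ 0) : y ∈ X :=
  Module.Basis.mem_span_image (T L) |>.mp hh (Finsupp.mem_support_iff.mpr hy)

theorem repr_eq_zero_of_mem_spanT {X : Set W} {h : Hecke L} (hh : h ∈ spanT L X) {y : W}
    (hy : y ∉ X) : (T L).repr h y = 0 :=
  not_ne_iff.mp (mt (mem_of_repr_ne_zero hh) hy)

theorem T_mem_spanT {X : Set W} {w : W} (hw : w ∈ X) : T L w ∈ spanT L X :=
  Submodule.subset_span ⟨w, hw, rfl⟩

theorem one_mem_spanT {X : Set W} (h : 1 ∈ X) : 1 ∈ spanT L X :=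
  T_one L ▸ T_mem_spanT h

theorem spanT_mono {X Y : Set W} (h : X ⊆ Y) : spanT L X ≤ spanT L Y :=
  Submodule.span_mono (Set.image_mono h)

theorem spanT_sup_spanT_compl (X : Set W) : spanT L X ⊔ spanT L Xᶜ = ⊤ := by
  rw [spanT, spanT, ← Submodule.span_union, ← Set.image_union, Set.union_compl_self,
    Set.image_univ, (T L).span_eq]

theorem mul_T_simple_mem_spanT {X : Set W} {i : B} (hX : ∀ w ∈ X, w * cs.simple i ∈ X)
    {h : Hecke L} (hh : h ∈ spanT L X) : h * T L (cs.simple i) ∈ spanT L X := by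
  refine mul_mem_of_forall_T_mul fun w hw => Submodule.smul_mem _ _ ?_
  have hwX := mem_of_repr_ne_zero hh hw
  rcases T_mul_T_simple L w i with e | e <;> rw [e]
  · exact T_mem_spanT (hX w hwX)
  · exact add_mem (T_mem_spanT (hX w hwX)) (Submodule.smul_mem _ _ (T_mem_spanT hwX))

theorem mul_Tsinv_mem_spanT {X : Set W} {i : B} (hX : ∀ w ∈ X, w * cs.simple i ∈ X)
    {h : Hecke L} (hh : h ∈ spanT L X) : h * Tsinv L i ∈ spanT L X := by
  rw [mul_Tsinv]
  exact sub_mem (mul_T_simple_mem_spanT hX hh) (Submodule.smul_mem _ _ hh)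

theorem mul_mem_spanT {J : Set B} {X : Set W} (hX : ∀ w ∈ X, ∀ i ∈ J, w * cs.simple i ∈ X)
    {h x : Hecke L} (hh : h ∈ spanT L X) (hx : x ∈ spanT L (parabolic cs J : Set W)) :
    h * x ∈ spanT L X := by
  refine mul_mem_of_forall_mul_T fun u hu => Submodule.smul_mem _ _ ?_
  refine T_induction L ?_ (fun y i hi ih => ?_) (fun y i hi ih => ?_) (mem_of_repr_ne_zero hx hu)
  · rwa [mul_one]
  · rw [← mul_assoc]
    exact mul_T_simple_mem_spanT (fun w hw => hX w hw i hi) ih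
  · rw [← mul_assoc]
    exact mul_Tsinv_mem_spanT (fun w hw => hX w hw i hi) ih

theorem mul_mem_spanT_parabolic {J : Set B} {h x : Hecke L}
    (hh : h ∈ spanT L (parabolic cs J : Set W)) (hx : x ∈ spanT L (parabolic cs J : Set W)) :
    h * x ∈ spanT L (parabolic cs J : Set W) :=
  mul_mem_spanT (fun _ hw _ hi => mul_mem hw (simple_mem_parabolic cs hi)) hh hx

theorem bar_mem_spanT {J : Set B} {h : Hecke L} (hh : h ∈ spanT L (parabolic cs J : Set W)) :
    bar L h ∈ spanT L (parabolic cs J : Set W) := by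
  have hmul : ∀ i ∈ J, ∀ w ∈ (parabolic cs J : Set W),
      w * cs.simple i ∈ (parabolic cs J : Set W) :=
    fun i hi w hw => mul_mem hw (simple_mem_parabolic cs hi)
  induction hh using Submodule.span_induction with
  | mem x hx =>
    obtain ⟨u, hu, rfl⟩ := hx
    refine T_induction L ?_ (fun y i hi ih => ?_) (fun y i hi ih => ?_) hu
    · rw [bar_one]
      exact one_mem_spanT (one_mem _)
    · rw [bar_mul, bar_T_simple]
      exact mul_Tsinv_mem_spanT (hmul i hi) ih
    · rw [bar_mul, bar_Tsinv]
      exact mul_T_simple_mem_spanT (hmul i hi) ih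
  | zero => exact bar_zero L ▸ zero_mem _
  | add x y _ _ hx hy => exact bar_add L x y ▸ add_mem hx hy
  | smul a x _ hx => exact bar_smul L a x ▸ Submodule.smul_mem _ _ hx

theorem commute_T_of_mem_parabolic {J : Set B} {h : Hecke L}
    (hh : ∀ i ∈ J, Commute h (T L (cs.simple i))) {u : W} (hu : u ∈ parabolic cs J) :
    Commute h (T L u) :=
  T_induction L (Commute.one_right _) (fun _ i hi ih => ih.mul_right (hh i hi))
    (fun _ i hi ih => ih.mul_right ((hh i hi).sub_right (Algebra.commutes _ _).symm)) hu

variable (L) in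
/-- The elements of the Hecke algebra all of whose coefficients lie in `P`. -/
noncomputable def coeffsIn (P : AddSubgroup (GroupRing Γ)) : AddSubgroup (Hecke L) where
  carrier := {h | ∀ y, (T L).repr h y ∈ P}
  zero_mem' y := by simp
  add_mem' ha hb y := by
    rw [map_add]
    exact add_mem (ha y) (hb y)
  neg_mem' ha y := by
    rw [map_neg]
    exact neg_mem (ha y)

theorem coeffsIn_mono {P Q : AddSubgroup (GroupRing Γ)} (h : P ≤ Q) :
    coeffsIn L P ≤ coeffsIn L Q :=
  fun _ hx y => h (hx y)

theorem smul_T_mem_coeffsIn {P : AddSubgroup (GroupRing Γ)} {a : GroupRing Γ} (ha : a ∈ P) (w : W) :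
    a • T L w ∈ coeffsIn L P := by
  classical
  intro y
  rw [map_smul, Module.Basis.repr_self, Finsupp.smul_single, smul_eq_mul, mul_one,
    Finsupp.single_apply]
  split_ifs
  exacts [ha, zero_mem _]

theorem smul_mem_coeffsIn {P Q : AddSubgroup (GroupRing Γ)} {a : GroupRing Γ}
    (ha : ∀ b ∈ P, a * b ∈ Q) {h : Hecke L} (hh : h ∈ coeffsIn L P) : a • h ∈ coeffsIn L Q := by
  intro y
  rw [map_smul, Finsupp.smul_apply, smul_eq_mul]
  exact ha _ (hh y)

theorem T_mem_coeffsIn {X : Set Γ} (h : 0 ∈ X) (w : W) : T L w ∈ coeffsIn L (supportedIn X) := by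
  rw [← one_smul (GroupRing Γ) (T L w)]
  exact smul_T_mem_coeffsIn (vpow_mem_supportedIn h) w

theorem mul_T_mem_coeffsIn_of_length_mul {P : AddSubgroup (GroupRing Γ)} {X : Set W} {h : Hecke L}
    (hh : h ∈ coeffsIn L P) (hX : h ∈ spanT L X) {r : W}
    (hr : ∀ w ∈ X, cs.length (w * r) = cs.length w + cs.length r) :
    h * T L r ∈ coeffsIn L P := by
  refine mul_mem_of_forall_T_mul fun w hw => ?_
  rw [T_mul L w r (hr w (mem_of_repr_ne_zero hX hw))]
  exact smul_T_mem_coeffsIn (hh w) _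

theorem T_mul_mem_coeffsIn_of_length_mul {P : AddSubgroup (GroupRing Γ)} {X : Set W} {h : Hecke L}
    (hh : h ∈ coeffsIn L P) (hX : h ∈ spanT L X) {a : W}
    (ha : ∀ w ∈ X, cs.length (a * w) = cs.length a + cs.length w) :
    T L a * h ∈ coeffsIn L P := by
  refine mul_mem_of_forall_mul_T fun w hw => ?_
  rw [T_mul L a w (ha w (mem_of_repr_ne_zero hX hw))]
  exact smul_T_mem_coeffsIn (hh w) _

theorem mul_T_simple_mem_coeffsIn {P : AddSubgroup (GroupRing Γ)} {i : B}
    (hP : ∀ b ∈ P, xi L i * b ∈ P) {h : Hecke L} (hh : h ∈ coeffsIn L P) :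
    h * T L (cs.simple i) ∈ coeffsIn L P := by
  refine mul_mem_of_forall_T_mul fun w _ => ?_
  rcases T_mul_T_simple L w i with e | e <;> rw [e]
  · exact smul_T_mem_coeffsIn (hh w) _
  · rw [smul_add, smul_smul, mul_comm]
    exact add_mem (smul_T_mem_coeffsIn (hh w) _) (smul_T_mem_coeffsIn (hP _ (hh w)) _)

theorem mul_Tsinv_mem_coeffsIn {P : AddSubgroup (GroupRing Γ)} {i : B}
    (hP : ∀ b ∈ P, xi L i * b ∈ P) {h : Hecke L} (hh : h ∈ coeffsIn L P) :
    h * Tsinv L i ∈ coeffsIn L P := by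
  rw [mul_Tsinv]
  exact sub_mem (mul_T_simple_mem_coeffsIn hP hh) (smul_mem_coeffsIn hP hh)

theorem mul_T_mem_coeffsIn {J : Set B} {P : AddSubgroup (GroupRing Γ)}
    (hP : ∀ i ∈ J, ∀ b ∈ P, xi L i * b ∈ P) {h : Hecke L} (hh : h ∈ coeffsIn L P) {u : W}
    (hu : u ∈ parabolic cs J) : h * T L u ∈ coeffsIn L P := by
  refine T_induction L ?_ (fun y i hi ih => ?_) (fun y i hi ih => ?_) hu
  · rwa [mul_one]
  · rw [← mul_assoc]
    exact mul_T_simple_mem_coeffsIn (hP i hi) ih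
  · rw [← mul_assoc]
    exact mul_Tsinv_mem_coeffsIn (hP i hi) ih

theorem isKL_iff {w : W} {C : Hecke L} :
    IsKL L w C ↔ bar L C = C ∧ C - T L w ∈ coeffsIn L (supportedIn (Set.Iio 0)) :=
  Iff.rfl

theorem tau_eq_zero_of_mem_spanT {X : Set W} (h1 : 1 ∉ X) {h : Hecke L} (hh : h ∈ spanT L X) :
    tau L h = 0 :=
  repr_eq_zero_of_mem_spanT hh h1

variable [IsOrderedAddMonoid Γ]

theorem isKL_KLelt (L : WeightFunction cs Γ) (w : W) : IsKL L w (KLelt L w) :=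
  (existsUnique_isKL L w).choose_spec.1

theorem IsKL.eq_KLelt {w : W} {C : Hecke L} (h : IsKL L w C) : KLelt L w = C :=
  (existsUnique_isKL L w).unique (isKL_KLelt L w) h

theorem eq_zero_of_bar_sub_mem_spanT {X : Set W} {h : Hecke L} (hh : h ∈ spanT L Xᶜ)
    (hneg : h ∈ coeffsIn L (supportedIn (Set.Iio 0))) (hbar : bar L h - h ∈ spanT L X) :
    h = 0 := by
  obtain ⟨k, hk⟩ := exists_mem_Fil L h
  induction k with
  | zero => exact eq_zero_of_mem_Fil_zero L hk
  | succ k ih =>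
    refine ih (mem_Fil_of_top L hk fun y hy => ?_)
    by_cases hyX : y ∈ X
    · exact repr_eq_zero_of_mem_spanT hh (Set.notMem_compl_iff.mpr hyX)
    · -- A coefficient in top length is bar-invariant modulo `spanT L X`.
      refine eq_zero_of_isNegative (hneg y) ?_
      rw [← repr_bar L hk y hy, ← sub_eq_zero, ← Finsupp.sub_apply, ← map_sub]
      exact repr_eq_zero_of_mem_spanT hbar hyX

theorem KLelt_mem_spanT {J : Set B} {w : W} (hw : w ∈ parabolic cs J) :
    KLelt L w ∈ spanT L (parabolic cs J : Set W) := by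
  obtain ⟨hbar, hneg⟩ := isKL_iff.mp (isKL_KLelt L w)
  have hsup : KLelt L w ∈ spanT L (parabolic cs J : Set W) ⊔ spanT L (parabolic cs J : Set W)ᶜ := by
    rw [spanT_sup_spanT_compl]
    exact Submodule.mem_top
  obtain ⟨g, hg, h, hh, hgh⟩ := Submodule.mem_sup.mp hsup
  rw [← hgh] at hbar hneg ⊢
  have hh_neg : h ∈ coeffsIn L (supportedIn (Set.Iio 0)) := by
    intro y
    by_cases hy : y ∈ parabolic cs J
    · rw [repr_eq_zero_of_mem_spanT hh (Set.notMem_compl_iff.mpr hy)]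
      exact zero_mem _
    · have hcoeff := hneg y
      rwa [add_sub_right_comm, map_add, Finsupp.add_apply,
        repr_eq_zero_of_mem_spanT (sub_mem hg (T_mem_spanT hw)) hy, zero_add] at hcoeff
  have hh_bar : bar L h - h ∈ spanT L (parabolic cs J : Set W) := by
    rw [bar_add, ← sub_eq_zero, add_sub_add_comm, add_eq_zero_iff_neg_eq, neg_sub] at hbar
    exact hbar ▸ sub_mem hg (bar_mem_spanT hg)
  rwa [eq_zero_of_bar_sub_mem_spanT hh hh_neg hh_bar, add_zero]

theorem KLelt_mem_coeffsIn (L : WeightFunction cs Γ) (w : W) :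
    KLelt L w ∈ coeffsIn L (supportedIn (Set.Iic 0)) := by
  rw [← sub_add_cancel (KLelt L w) (T L w)]
  exact add_mem (coeffsIn_mono (supportedIn_mono Set.Iio_subset_Iic_self)
    (isKL_iff.mp (isKL_KLelt L w)).2) (T_mem_coeffsIn Set.self_mem_Iic w)

theorem KLelt_mul_KLelt {J : Set B} {P : AddSubgroup (GroupRing Γ)}
    (hneg : P ≤ supportedIn (Set.Iio 0)) (hP : ∀ i ∈ J, ∀ b ∈ P, xi L i * b ∈ P) {a u : W}
    (hu : u ∈ parabolic cs J)
    (hlen : ∀ w ∈ parabolic cs J, cs.length (a * w) = cs.length a + cs.length w)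
    (ha : KLelt L a - T L a ∈ coeffsIn L P) :
    KLelt L a * KLelt L u = KLelt L (a * u) := by
  obtain ⟨hbar_a, -⟩ := isKL_iff.mp (isKL_KLelt L a)
  obtain ⟨hbar_u, hneg_u⟩ := isKL_iff.mp (isKL_KLelt L u)
  have hspan := KLelt_mem_spanT (L := L) hu
  have hleft : (KLelt L a - T L a) * KLelt L u ∈ coeffsIn L (supportedIn (Set.Iio 0)) := by
    refine mul_mem_of_forall_mul_T fun w hw => smul_mem_coeffsIn (P := P) (fun b hb => ?_)
      (mul_T_mem_coeffsIn hP ha (mem_of_repr_ne_zero hspan hw))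
    exact mul_mem_supportedIn (fun _ hα _ hβ => add_neg_of_nonpos_of_neg hα hβ)
      (KLelt_mem_coeffsIn L u w) (hneg hb)
  have hright : T L a * (KLelt L u - T L u) ∈ coeffsIn L (supportedIn (Set.Iio 0)) :=
    T_mul_mem_coeffsIn_of_length_mul hneg_u (sub_mem hspan (T_mem_spanT hu)) hlen
  have hsplit : KLelt L a * KLelt L u - T L (a * u) =
      (KLelt L a - T L a) * KLelt L u + T L a * (KLelt L u - T L u) := by
    rw [← T_mul L a u (hlen u hu), sub_mul, mul_sub]
    abel
  refine (IsKL.eq_KLelt (isKL_iff.mpr ⟨?_, ?_⟩)).symm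
  · rw [bar_mul, hbar_a, hbar_u]
  · rw [hsplit]
    exact add_mem hleft hright

end HeckeAlgebra

section VDegree

theorem Vpow_mul (k m : ℤ) : Vpow k * Vpow m = Vpow (k + m) := by
  rw [Vpow, Vpow, vpow_mul, ← toLex_add, Prod.mk_add_mk, add_zero, Vpow]

theorem Vpow_zero : Vpow 0 = 1 := rfl

theorem barA_Vpow (k : ℤ) : barA (Vpow k) = Vpow (-k) := by
  rw [Vpow, barA_vpow, ← toLex_neg, Prod.neg_mk, neg_zero, Vpow]

/-- The elements of `A` of degree at most `k` in `V`. -/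
def vDegLE (k : ℤ) : AddSubgroup (GroupRing (ℤ ×ₗ ℤ)) := supportedIn {γ | (ofLex γ).1 ≤ k}

theorem mul_mem_vDegLE {k m : ℤ} {a b : GroupRing (ℤ ×ₗ ℤ)} (ha : a ∈ vDegLE k)
    (hb : b ∈ vDegLE m) : a * b ∈ vDegLE (k + m) := by
  refine mul_mem_supportedIn (fun α hα β hβ => ?_) ha hb
  rw [Set.mem_ofPred_eq] at hα hβ ⊢
  exact add_le_add hα hβ

theorem Vpow_mem_vDegLE (k : ℤ) : Vpow k ∈ vDegLE k :=
  vpow_mem_supportedIn (le_refl k)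

theorem vDegLE_mono {k m : ℤ} (h : k ≤ m) : vDegLE k ≤ vDegLE m :=
  supportedIn_mono fun _ hγ => le_trans hγ h

theorem vDegLE_neg_one_le : vDegLE (-1) ≤ supportedIn (Set.Iio 0) :=
  supportedIn_mono fun _ hγ => Prod.Lex.lt_iff.mpr (Or.inl (hγ.trans_lt neg_one_lt_zero))

theorem weight_LB_simple {n : ℕ} (i : Fin n) : (LB n).toFun ((csB n).simple i) =
    toLex (if i.val = 0 then (1, 0) else (0, 1)) := by
  change toLex ((ellT n ((csB n).simple i) : ℤ), ellS n ((csB n).simple i)) = _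
  rw [ellS, ellT_simple, (csB n).length_simple]
  split_ifs <;> simp

theorem xi_LB_mul_mem_vDegLE {n : ℕ} {i : Fin n} (hi : 1 ≤ i.val) {k : ℤ} :
    ∀ b ∈ vDegLE k, xi (LB n) i * b ∈ vDegLE k := by
  intro b hb
  have hξ : xi (LB n) i ∈ vDegLE 0 := by
    rw [xi, weight_LB_simple, if_neg (by omega)]
    exact sub_mem (vpow_mem_supportedIn (le_refl (0 : ℤ))) (vpow_mem_supportedIn (le_refl (0 : ℤ)))
  exact zero_add k ▸ mul_mem_vDegLE hξ hb

theorem xi_LB_zero {n : ℕ} (hn : 0 < n) : xi (LB n) ⟨0, hn⟩ = Vpow 1 - Vpow (-1) := by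
  rw [xi, weight_LB_simple, if_pos rfl, Vpow, Vpow, ← toLex_neg, Prod.neg_mk, neg_zero]

end VDegree

section Generators

/-- The generators `T_{s_k}` (with `s_0 = t`) of the Hecke algebra as units. -/
noncomputable def genUnit (n k : ℕ) : (HB n)ˣ := TUnit (LB n) (sB n k)

theorem genUnit_val {n k : ℕ} (hk : k < n) :
    (genUnit n k).val = T (LB n) ((csB n).simple ⟨k, hk⟩) := by
  rw [← dif_pos (c := k < n) (t := fun h => (csB n).simple ⟨k, h⟩) (e := fun _ => 1) hk]
  rfl

theorem genUnit_inv_val {n k : ℕ} (hk : k < n) :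
    (genUnit n k)⁻¹.val = Tsinv (LB n) ⟨k, hk⟩ := by
  rw [genUnit, sB, dif_pos hk, TUnit_simple_inv]

theorem sB_comm_of_lt {n i k : ℕ} (h : i + 2 ≤ k) (hk : k < n) :
    Commute (sB n i) (sB n k) := by
  have hpow := (csB n).simple_mul_simple_pow ⟨i, by omega⟩ ⟨k, hk⟩
  rw [matB_apply, if_neg (by grind), if_neg (by grind), if_neg (by grind),
    pow_two, mul_eq_one_iff_eq_inv, mul_inv_rev, (csB n).inv_simple, (csB n).inv_simple] at hpow
  rw [sB, dif_pos (by omega : i < n), sB, dif_pos hk]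
  exact hpow

theorem sB_braid_zero {n : ℕ} (hn : 1 < n) :
    sB n 0 * sB n 1 * sB n 0 * sB n 1 = sB n 1 * sB n 0 * sB n 1 * sB n 0 := by
  have hpow := (csB n).simple_mul_simple_pow ⟨0, by omega⟩ ⟨1, hn⟩
  rw [matB_apply, if_neg (by simp), if_pos (by simp), ← pow_mul_pow_sub _ (by norm_num : 2 ≤ 4),
    mul_eq_one_iff_eq_inv, pow_two, ← mul_assoc] at hpow
  rw [sB, dif_pos (by omega : 0 < n), sB, dif_pos hn, hpow]
  simp [mul_assoc]

theorem genUnit_prod_val {n : ℕ} {ks : List ℕ}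
    (h : ks.length ≤ (csB n).length (ks.map (sB n)).prod) :
    (ks.map (genUnit n)).prod.val = T (LB n) (ks.map (sB n)).prod := by
  have hsum : ((ks.map (sB n)).map (csB n).length).sum ≤ ks.length := by
    simpa using List.sum_le_card_nsmul ((ks.map (sB n)).map (csB n).length) 1 (by
      simpa using fun k _ => length_sB_le n k)
  rw [← prod_map_T (LB n) (hsum.trans h), List.map_map, ← Units.coeHom_apply, map_list_prod,
    List.map_map]
  rfl

theorem genUnit_prod_eq {n : ℕ} {ks ks' : List ℕ}
    (hprod : (ks.map (sB n)).prod = (ks'.map (sB n)).prod) (hlen : ks.length = ks'.length)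
    (hred : ks.length ≤ (csB n).length (ks.map (sB n)).prod) :
    (ks.map (genUnit n)).prod = (ks'.map (genUnit n)).prod :=
  Units.ext (by rw [genUnit_prod_val hred, genUnit_prod_val (hlen ▸ hprod ▸ hred), hprod])

theorem length_sB {n k : ℕ} (hk : k < n) : (csB n).length (sB n k) = 1 := by
  rw [sB, dif_pos hk, (csB n).length_simple]

theorem braidRelations_genUnit (n : ℕ) : BraidRelations n (genUnit n) where
  comm i k h hk := by
    have hred := length_mul_cosetB hk (j := 1) (by omega) (sB_mem_parB (k := i) (by omega)
      (by omega))
    have heq := genUnit_prod_eq (n := n) (ks := [i, k]) (ks' := [k, i])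
      (by simpa using (sB_comm_of_lt h hk).eq) rfl
      (by simpa [cosetB, length_sB (show i < n by omega)] using hred.ge)
    simpa [Commute, SemiconjBy] using heq
  braid i hi hk := by
    have hred := length_mul_cosetB hk (j := 2) (by omega) (sB_mem_parB (k := i) (by omega)
      (by omega))
    have heq := genUnit_prod_eq (n := n) (ks := [i, i + 1, i]) (ks' := [i + 1, i, i + 1])
      (by simpa [mul_assoc] using (sB_braid n i hi hk).symm) rfl
      (by simpa [cosetB, length_sB (show i < n by omega)] using hred.ge)
    simpa [mul_assoc] using heq.symm
  braid_zero hn := by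
    have hred := length_mul_tB hn (sB_mem_parB (k := 0) (by omega) (by omega))
    have heq := genUnit_prod_eq (n := n) (ks := [0, 1, 0, 1]) (ks' := [1, 0, 1, 0])
      (by simpa [mul_assoc] using sB_braid_zero hn) rfl
      (by simpa [tB, mul_assoc, length_sB (show 0 < n by omega)] using hred.ge)
    simpa [mul_assoc] using heq

/-- The parameters `v ^ L(s_k) - v ^ (-L(s_k))`, extended by `0` to `k ≥ n`. -/
noncomputable def xiB (n k : ℕ) : GroupRing (ℤ ×ₗ ℤ) :=
  if h : k < n then xi (LB n) ⟨k, h⟩ else 0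

theorem genUnit_mul_self (n : ℕ) : ∀ i < n, (genUnit n i : HB n) * genUnit n i =
    1 + algebraMap (GroupRing (ℤ ×ₗ ℤ)) (HB n) (xiB n i) * genUnit n i := by
  intro i hi
  rw [genUnit_val hi, xiB, dif_pos hi, T_simple_sq, Algebra.smul_def]

theorem T_tB {n l : ℕ} (hl : l < n) :
    T (LB n) (tB n (l + 1)) = (jucysMurphy (genUnit n) (l + 1)).val := by
  induction l with
  | zero => rfl
  | succ l ih =>
    have hsum : (([sB n (l + 1), tB n (l + 1), sB n (l + 1)]).map (csB n).length).sum ≤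
        (csB n).length ([sB n (l + 1), tB n (l + 1), sB n (l + 1)]).prod := by
      have hlen := length_tB hl
      have hlen' := length_tB (show l < n by omega)
      have hs := length_sB hl
      rw [tB, mul_assoc] at hlen
      simp only [List.map_cons, List.map_nil, List.sum_cons, List.sum_nil, List.prod_cons,
        List.prod_nil, mul_one]
      omega
    have hT := prod_map_T (LB n) hsum
    simp only [List.map_cons, List.map_nil, List.prod_cons, List.prod_nil, mul_one,
      ← mul_assoc] at hT
    rw [tB, ← hT, ih (by omega)]
    rfl

theorem PB_eq_shiftedProd {n l : ℕ} (hl : l ≤ n) :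
    PB n l = shiftedProd (genUnit n) (Vpow (-1)) l := by
  rw [PB, shiftedProd]
  congr 1
  refine List.map_congr_left fun i hi => ?_
  rw [T_tB ((List.mem_range.mp hi).trans_le hl)]

theorem T_cosetB {n l : ℕ} (hl : l < n) :
    T (LB n) (cosetB n l l) = (descProd (genUnit n) l).val := by
  induction l with
  | zero => exact T_one _
  | succ l ih =>
    have hlen : (csB n).length (sB n (l + 1) * cosetB n l l) =
        (csB n).length (sB n (l + 1)) + (csB n).length (cosetB n l l) := by
      rw [← cosetB_succ, length_cosetB hl le_rfl, length_cosetB (by omega) le_rfl, length_sB hl,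
        add_comm]
    rw [cosetB_succ, ← T_mul _ _ _ hlen, ih (by omega)]
    rfl

theorem T_rB {n l : ℕ} (hl : l < n) :
    T (LB n) (rB n (l + 1)) = (descProd (genUnit n) l).val * (genUnit n 0).val := by
  induction l with
  | zero => exact (one_mul _).symm
  | succ l ih =>
    have hlen : (csB n).length (sB n (l + 1) * rB n (l + 1)) =
        (csB n).length (sB n (l + 1)) + (csB n).length (rB n (l + 1)) := by
      rw [length_rB (show l < n by omega), length_sB hl, add_comm 1]
      exact length_rB hl
    rw [rB, ← T_mul _ _ _ hlen, ih (by omega), ← mul_assoc]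
    rfl

theorem bar_descProd {n l : ℕ} (hl : l < n) :
    bar (LB n) (descProd (genUnit n) l).val = (descProd (genUnit n)⁻¹ l).val := by
  induction l with
  | zero => exact bar_one _
  | succ l ih =>
    rw [descProd, descProd, Units.val_mul, Units.val_mul, bar_mul, ih (by omega), genUnit_val hl,
      bar_T_simple, Pi.inv_apply, genUnit_inv_val hl]

theorem T_tB_mul_descProd_inv {n l : ℕ} (hl : l < n) :
    T (LB n) (tB n (l + 1)) * (descProd (genUnit n)⁻¹ l).val = T (LB n) (rB n (l + 1)) := by
  rw [T_tB hl, ← Units.val_mul, jucysMurphy_mul_descProd_inv, Units.val_mul, T_rB hl]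

end Generators

section BarInvariance

theorem commute_TinvB_of_mem_symB {n l : ℕ} {h : HB n}
    (hh : ∀ k, 1 ≤ k → k < l → Commute h (genUnit n k).val) {u : WB n} (hu : u ∈ symB n l) :
    Commute h (TinvB n u) := by
  rw [symB_eq_parabolic] at hu
  refine Commute.units_inv_right (u := TUnit (LB n) u) (commute_T_of_mem_parabolic ?_ hu)
  intro i hi
  rw [← genUnit_val i.isLt]
  exact hh i hi.1 hi.2

theorem commute_PB_TinvB {n l : ℕ} (hl : l ≤ n) : Commute (PB n l) (TinvB n (sigmaB n l)) := by
  refine commute_TinvB_of_mem_symB (fun k hk hkl => ?_) (sigmaB_spec n l).1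
  rw [PB_eq_shiftedProd hl]
  exact ((braidRelations_genUnit n).commute_shiftedProd (genUnit_mul_self n) _ hk hkl hl).symm

theorem commute_T_tB_TinvB {n l : ℕ} (hl : l < n) :
    Commute (T (LB n) (tB n (l + 1))) (TinvB n (sigmaB n l)) := by
  refine commute_TinvB_of_mem_symB (fun k _ hkl => ?_) (sigmaB_spec n l).1
  rw [T_tB hl]
  exact ((braidRelations_genUnit n).commute_jucysMurphy hkl hl).symm.units_val

theorem TinvB_sigmaB_zero (n : ℕ) : TinvB n (sigmaB n 0) = 1 := by
  have hsigma : sigmaB n 0 = 1 := by simpa [symB] using (sigmaB_spec n 0).1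
  have hunit : TUnit (LB n) 1 = 1 := Units.ext (T_one _)
  rw [TinvB, hsigma, hunit, inv_one, Units.val_one]

theorem TinvB_sigmaB_succ {n l : ℕ} (hl : l < n) : TinvB n (sigmaB n (l + 1)) =
    TinvB n (sigmaB n l) * (descProd (genUnit n)⁻¹ l).val := by
  have hsigma : sigmaB n (l + 1) = (cosetB n l l)⁻¹ * sigmaB n l := by
    rw [← sigmaB_inv (l := l + 1) hl, sigmaB_succ hl, mul_inv_rev, sigmaB_inv hl.le]
  have hlen : (csB n).length ((cosetB n l l)⁻¹ * sigmaB n l) =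
      (csB n).length (cosetB n l l)⁻¹ + (csB n).length (sigmaB n l) := by
    rw [← hsigma, ← sigmaB_inv (l := l + 1) hl, (csB n).length_inv, (csB n).length_inv,
      sigmaB_succ hl, length_mul_cosetB hl le_rfl (symB_le_parB n l (sigmaB_spec n l).1),
      length_cosetB hl le_rfl, add_comm]
  have hunit : TUnit (LB n) (sigmaB n (l + 1)) =
      TUnit (LB n) (cosetB n l l)⁻¹ * TUnit (LB n) (sigmaB n l) :=
    Units.ext (by rw [hsigma]; exact (T_mul _ _ _ hlen).symm)
  rw [TinvB, TinvB, hunit, mul_inv_rev, Units.val_mul, ← bar_T, T_cosetB hl, bar_descProd hl]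

theorem PB_succ (n l : ℕ) : PB n (l + 1) = PB n l * (T (LB n) (tB n (l + 1)) +
    algebraMap (GroupRing (ℤ ×ₗ ℤ)) (HB n) (Vpow (-1))) := by
  simp [PB, List.range_succ]

theorem PB_mul_TinvB_succ {n l : ℕ} (hl : l < n) :
    PB n (l + 1) * TinvB n (sigmaB n (l + 1)) = PB n l * TinvB n (sigmaB n l) *
      (T (LB n) (rB n (l + 1)) + algebraMap (GroupRing (ℤ ×ₗ ℤ)) (HB n) (Vpow (-1)) *
        (descProd (genUnit n)⁻¹ l).val) := by
  have hcomm : Commute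
      (T (LB n) (tB n (l + 1)) + algebraMap (GroupRing (ℤ ×ₗ ℤ)) (HB n) (Vpow (-1)))
      (TinvB n (sigmaB n l)) :=
    (commute_T_tB_TinvB hl).add_left (Algebra.commutes _ _)
  rw [PB_succ, TinvB_sigmaB_succ hl, mul_assoc (PB n l), ← mul_assoc _ (TinvB n (sigmaB n l)),
    hcomm.eq, mul_assoc (TinvB n (sigmaB n l)), add_mul, T_tB_mul_descProd_inv hl, mul_assoc]

theorem PB_mul_bar_eq {n l : ℕ} (hl : l < n) :
    PB n l * bar (LB n) (T (LB n) (rB n (l + 1)) +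
        algebraMap (GroupRing (ℤ ×ₗ ℤ)) (HB n) (Vpow (-1)) * (descProd (genUnit n)⁻¹ l).val) =
      PB n l * (T (LB n) (rB n (l + 1)) +
        algebraMap (GroupRing (ℤ ×ₗ ℤ)) (HB n) (Vpow (-1)) * (descProd (genUnit n)⁻¹ l).val) := by
  have hn : 0 < n := by omega
  have hbar_desc : bar (LB n) (descProd (genUnit n)⁻¹ l).val = (descProd (genUnit n) l).val := by
    rw [← bar_descProd hl, bar_bar]
  have hbar_zero : bar (LB n) (genUnit n 0).val = (genUnit n 0)⁻¹.val := by
    rw [genUnit_val hn, bar_T_simple, genUnit_inv_val hn]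
  rw [T_rB hl, bar_add, bar_mul, bar_mul, bar_descProd hl, hbar_desc, hbar_zero, bar_algebraMap,
    barA_Vpow, neg_neg, PB_eq_shiftedProd hl.le]
  exact (braidRelations_genUnit n).shiftedProd_mul_eq (genUnit_mul_self n)
    (by rw [Vpow_mul, neg_add_cancel, Vpow_zero]) (by rw [xiB, dif_pos hn, xi_LB_zero]) hl

theorem bar_PB_mul_TinvB {n l : ℕ} (hl : l ≤ n) :
    bar (LB n) (PB n l * TinvB n (sigmaB n l)) = PB n l * TinvB n (sigmaB n l) := by
  induction l with
  | zero =>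
    rw [TinvB_sigmaB_zero, mul_one]
    exact bar_one _
  | succ l ih =>
    rw [PB_mul_TinvB_succ hl, bar_mul, ih (by omega), (commute_PB_TinvB (by omega)).eq, mul_assoc,
      mul_assoc, PB_mul_bar_eq hl]

end BarInvariance

section Triangularity

theorem mul_mem_spanT_symB {n l : ℕ} {X : Set (WB n)}
    (hX : ∀ w ∈ X, ∀ u ∈ symB n l, w * u ∈ X) {h x : HB n} (hh : h ∈ spanT (LB n) X)
    (hx : x ∈ spanT (LB n) (symB n l : Set (WB n))) : h * x ∈ spanT (LB n) X := by
  rw [symB_eq_parabolic] at hX hx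
  exact mul_mem_spanT (fun w hw i hi => hX w hw _ (simple_mem_parabolic _ hi)) hh hx

theorem tB_mem_parB {n l i : ℕ} (hi : i < l) (hl : l ≤ n) : tB n (i + 1) ∈ parB n l := by
  induction i with
  | zero => exact sB_mem_parB hi (by omega)
  | succ i ih =>
    have h : sB n (i + 1) ∈ parB n l := sB_mem_parB hi (by omega)
    exact mul_mem (mul_mem h (ih (by omega))) h

theorem PB_mem_spanT {n l : ℕ} (hl : l ≤ n) :
    PB n l ∈ spanT (LB n) (parB n l : Set (WB n)) := by
  have hprod : ∀ m ≤ l, PB n m ∈ spanT (LB n) (parB n l : Set (WB n)) := by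
    intro m
    induction m with
    | zero => exact fun _ => one_mem_spanT (one_mem _)
    | succ m ih =>
      intro hm
      rw [PB_succ, Algebra.algebraMap_eq_smul_one]
      exact mul_mem_spanT_parabolic (ih (by omega)) (add_mem (T_mem_spanT (tB_mem_parB hm hl))
        (Submodule.smul_mem _ _ (one_mem_spanT (one_mem _))))
  exact hprod l le_rfl

theorem TinvB_mem_spanT {n l : ℕ} {u : WB n} (hu : u ∈ symB n l) :
    TinvB n u ∈ spanT (LB n) (symB n l : Set (WB n)) := by
  rw [TinvB, ← inv_inv u, ← bar_T]
  rw [symB_eq_parabolic] at hu ⊢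
  exact bar_mem_spanT (T_mem_spanT (inv_mem hu))

theorem PB_mul_TinvB_mem_spanT {n l : ℕ} (hl : l ≤ n) :
    PB n l * TinvB n (sigmaB n l) ∈ spanT (LB n) (parB n l : Set (WB n)) :=
  mul_mem_spanT_parabolic (PB_mem_spanT hl)
    (spanT_mono (symB_le_parB n l) (TinvB_mem_spanT (sigmaB_spec n l).1))

theorem mul_descProd_inv_mem_coeffsIn {n l : ℕ} (hl : l < n) {k : ℤ} {h : HB n}
    (hh : h ∈ coeffsIn (LB n) (vDegLE k)) :
    h * (descProd (genUnit n)⁻¹ l).val ∈ coeffsIn (LB n) (vDegLE k) := by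
  induction l generalizing h with
  | zero => simpa [descProd] using hh
  | succ l ih =>
    rw [descProd, Units.val_mul, Pi.inv_apply, genUnit_inv_val hl, ← mul_assoc]
    exact ih (by omega) (mul_Tsinv_mem_coeffsIn (xi_LB_mul_mem_vDegLE (by simp)) hh)

theorem mem_coeffsIn_vDegLE_zero_of_sub_T_mem {n : ℕ} {h : HB n} {w : WB n}
    (hh : h - T (LB n) w ∈ coeffsIn (LB n) (vDegLE (-1))) : h ∈ coeffsIn (LB n) (vDegLE 0) := by
  rw [← sub_add_cancel h (T (LB n) w)]
  exact add_mem (coeffsIn_mono (vDegLE_mono neg_one_lt_zero.le) hh)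
    (T_mem_coeffsIn (le_refl (0 : ℤ)) w)

theorem PB_mul_TinvB_sub_T_aB_mem {n l : ℕ} (hl : l ≤ n) :
    PB n l * TinvB n (sigmaB n l) - T (LB n) (aB n l) ∈ coeffsIn (LB n) (vDegLE (-1)) := by
  induction l with
  | zero =>
    rw [TinvB_sigmaB_zero, mul_one, show aB n 0 = 1 from rfl, T_one, show PB n 0 = 1 from rfl,
      sub_self]
    exact zero_mem _
  | succ l ih =>
    have ha : aB n l ∈ parB n l := aB_mem_parB (by omega)
    have hr : ∀ w ∈ parB n l, (csB n).length (w * rB n (l + 1)) =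
        (csB n).length w + (csB n).length (rB n (l + 1)) := fun w hw => by
      rw [length_mul_rB hl hw, length_rB hl]
    have hE := PB_mul_TinvB_mem_spanT (show l ≤ n by omega)
    have hd := ih (by omega)
    rw [PB_mul_TinvB_succ hl]
    generalize PB n l * TinvB n (sigmaB n l) = E at hE hd ⊢
    have hsplit : E * (T (LB n) (rB n (l + 1)) + algebraMap (GroupRing (ℤ ×ₗ ℤ)) (HB n)
          (Vpow (-1)) * (descProd (genUnit n)⁻¹ l).val) - T (LB n) (aB n (l + 1)) =
        (E - T (LB n) (aB n l)) * T (LB n) (rB n (l + 1)) +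
          Vpow (-1) • (E * (descProd (genUnit n)⁻¹ l).val) := by
      rw [aB_succ, ← T_mul _ _ _ (hr _ ha), ← Algebra.smul_def, mul_add, mul_smul_comm, sub_mul]
      abel
    rw [hsplit]
    refine add_mem (mul_T_mem_coeffsIn_of_length_mul hd (sub_mem hE (T_mem_spanT ha)) hr) ?_
    have hVpow : ∀ b ∈ vDegLE 0, Vpow (-1) * b ∈ vDegLE (-1) := fun b hb =>
      add_zero (-1 : ℤ) ▸ mul_mem_vDegLE (Vpow_mem_vDegLE (-1)) hb
    exact smul_mem_coeffsIn hVpow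
      (mul_descProd_inv_mem_coeffsIn hl (mem_coeffsIn_vDegLE_zero_of_sub_T_mem hd))

theorem CB_aB {n l : ℕ} (hl : l ≤ n) : CB n (aB n l) = PB n l * TinvB n (sigmaB n l) :=
  (isKL_iff.mpr ⟨bar_PB_mul_TinvB hl,
    coeffsIn_mono vDegLE_neg_one_le (PB_mul_TinvB_sub_T_aB_mem hl)⟩).eq_KLelt

theorem CB_mem_spanT {n l : ℕ} {u : WB n} (hu : u ∈ symB n l) :
    CB n u ∈ spanT (LB n) (symB n l : Set (WB n)) := by
  rw [symB_eq_parabolic] at hu ⊢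
  exact KLelt_mem_spanT hu

theorem CB_aB_mul_CB {n l : ℕ} (hl : l ≤ n) {u : WB n} (hu : u ∈ symB n n) :
    CB n (aB n l) * CB n u = CB n (aB n l * u) := by
  refine KLelt_mul_KLelt vDegLE_neg_one_le (fun i hi => xi_LB_mul_mem_vDegLE hi.1)
    (symB_eq_parabolic n n ▸ hu) (fun w hw => ?_) ?_
  · exact length_aB_mul hl (symB_eq_parabolic n n ▸ hw)
  · rw [show KLelt (LB n) (aB n l) = _ from CB_aB hl]
    exact PB_mul_TinvB_sub_T_aB_mem hl

end Triangularity

section Trace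

theorem T_tB_eq_T_rB_mul {n l : ℕ} (hl : l < n) : T (LB n) (tB n (l + 1)) =
    T (LB n) (rB n (l + 1)) * T (LB n) (cosetB n l l)⁻¹ := by
  have h := T_tB_mul_descProd_inv hl
  rwa [← bar_descProd hl, ← T_cosetB hl, bar_T, Units.mul_inv_eq_iff_eq_mul] at h

theorem PB_mul_T_rB_mem_spanT {n l : ℕ} (hl : l < n) :
    PB n l * T (LB n) (rB n (l + 1)) ∈ spanT (LB n) (symB n n : Set (WB n))ᶜ := by
  refine mul_mem_of_forall_T_mul fun w hw => ?_
  have hw : w ∈ parB n l := mem_of_repr_ne_zero (PB_mem_spanT hl.le) hw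
  rw [T_mul _ _ _ (by rw [length_mul_rB hl hw, length_rB hl])]
  exact Submodule.smul_mem _ _ (T_mem_spanT (mul_rB_notMem_symB hl hw))

theorem PB_mul_T_tB_mul_mem_spanT {n l : ℕ} (hl : l < n) {h : HB n}
    (hh : h ∈ spanT (LB n) (symB n n : Set (WB n))) :
    PB n l * T (LB n) (tB n (l + 1)) * h ∈ spanT (LB n) (symB n n : Set (WB n))ᶜ := by
  have hX : ∀ w ∈ (symB n n : Set (WB n))ᶜ, ∀ u ∈ symB n n, w * u ∈ (symB n n : Set (WB n))ᶜ :=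
    fun w hw u hu hwu => hw ((Subgroup.mul_mem_cancel_right _ hu).mp hwu)
  have hcoset : (cosetB n l l)⁻¹ ∈ symB n n :=
    inv_mem (symB_mono n hl (cosetB_mem_symB hl le_rfl))
  rw [T_tB_eq_T_rB_mul hl, ← mul_assoc]
  exact mul_mem_spanT_symB hX
    (mul_mem_spanT_symB hX (PB_mul_T_rB_mem_spanT hl) (T_mem_spanT hcoset)) hh

theorem tau_PB_mul {n l : ℕ} (hl : l ≤ n) {h : HB n}
    (hh : h ∈ spanT (LB n) (symB n n : Set (WB n))) :
    tau (LB n) (PB n l * h) = Vpow (-(l : ℤ)) * tau (LB n) h := by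
  induction l with
  | zero => rw [show PB n 0 = 1 from rfl, one_mul, Nat.cast_zero, neg_zero, Vpow_zero, one_mul]
  | succ l ih =>
    have htau : tau (LB n) (PB n l * T (LB n) (tB n (l + 1)) * h) = 0 :=
      tau_eq_zero_of_mem_spanT (not_not.mpr (one_mem _)) (PB_mul_T_tB_mul_mem_spanT hl hh)
    rw [PB_succ, mul_add, add_mul, map_add, htau, zero_add, ← Algebra.commutes, mul_assoc,
      ← Algebra.smul_def, map_smul, ih (by omega), smul_eq_mul, ← mul_assoc, Vpow_mul,
      Nat.cast_succ, neg_add_rev]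

end Trace

end CoxeterKL

open CoxeterKL in
theorem proposition2p4 (n : ℕ) (hn : 1 ≤ n) (l : ℕ) (hl : l ≤ n) :
    CB n (aB n l) = PB n l * TinvB n (sigmaB n l) ∧
    CB n (aB n l) = TinvB n (sigmaB n l) * PB n l ∧
    ∀ σ ∈ symB n n,
      CB n (aB n l) * CB n σ = CB n (aB n l * σ) ∧
      tau (LB n) (CB n (aB n l * σ)) =
        Vpow (-(l : ℤ)) * tau (LB n) (TinvB n (sigmaB n l) * CB n σ) := by
  refine ⟨CB_aB hl, (CB_aB hl).trans (commute_PB_TinvB hl).eq, fun σ hσ =>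
    ⟨CB_aB_mul_CB hl hσ, ?_⟩⟩
  have hspan : TinvB n (sigmaB n l) * CB n σ ∈ spanT (LB n) (symB n n : Set (WB n)) :=
    mul_mem_spanT_symB (fun _ hw _ hu => mul_mem hw hu)
      (TinvB_mem_spanT (symB_mono n hl (sigmaB_spec n l).1)) (CB_mem_spanT hσ)
  rw [← CB_aB_mul_CB hl hσ, CB_aB hl, mul_assoc, tau_PB_mul hl hspan]
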